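/- For each $n=1,2,\dots$ let $m_n\ge 1$ be an integer, let $X_n$ be a random variable with $\mathbb P(X_n=i)=p_n(i)>0$ for $i=1,\dots,m_n$, where $\sum_{i=1}^{m_n}p_n(i)=1$, and let $X_{n,1},\dots,X_{n,n}$ be i.i.d. random variables with the same distribution as $X_n$. Let $$\hat p_n(i)=\frac1n\sum_{k=1}^n I(X_{n,k}=i),\qquad \chi_n^2=n\sum_{i=1}^{m_n}\frac{(\hat p_n(i)-p_n(i))^2}{p_n(i)}$$ be the empirical frequencies and the Pearson chi-square statistic. Write $p_n^{-a}(X_n)$ for $(p_n(X_n))^{-a}$. Assume that, as $n\to\infty$, $m_n\to\infty$, $$\text{(C)}\qquad \frac{1}{m_n n}\,\mathbb{V}\mathrm{ar}\,\bigl(p_n^{-1}(X_n)\bigr)\to 0 ,\qquad\text{and}\qquad \frac{n}{\sqrt{m_n}}\to\infty ,$$ and that for some $\delta>0$ $$\sup_{n\ge1}\; m_n^{-(1+\delta)}\,\mathbb E\,p_n^{-(1+\delta)}(X_n)<\infty .$$ Then $$\frac{\chi_n^2-m_n}{\sqrt{2m_n}}\ \xrightarrow{\,d\,}\ N,\qquad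 N\sim \mathrm{Norm}(0,1),$$ as $n\to\infty$. -/

import Mathlib

open MeasureTheory ProbabilityTheory Filter Topology

noncomputable section

/-- Empirical frequency of the class `i` in the sample `X 0, …, X (n - 1)`. -/
def empFreq {n m : ℕ} {Ω : Type*} (X : Fin n → Ω → Fin m) (i : Fin m) (ω : Ω) : ℝ :=
  (n : ℝ)⁻¹ * ∑ k : Fin n, if X k ω = i then (1 : ℝ) else 0

/-- Pearson's chi-square statistic of the sample `X 0, …, X (n - 1)` for the class
probabilities `p`. -/
def pearsonChiSq {n m : ℕ} {Ω : Type*} (p : Fin m → ℝ) (X : Fin n → Ω → Fin m) (ω : Ω) : ℝ :=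
  (n : ℝ) * ∑ i : Fin m, (empFreq X i ω - p i) ^ 2 / p i

end

/-! Put h(a,b) = 1{a=b}/p(a) − 1. Then χ² = (1/n) ∑_{k,l} h(X_k,X_l), and h is the kernel of the
orthogonal projection of L²(p) onto mean-zero functions. Hence E h(b,X) = 0 and E h(X,b)h(X,c) =
h(b,c) (`sum_mul_pearsonKernel_mul`). The diagonal terms, once centred, have variance n·Var(1/p(X)).
After standardization, (C) and m → ∞ remove them together with a deterministic −1/√(2m)
(`prodExp_abs_remainder_le`). The normalized off-diagonal sum W carries the limit.

Stein's method is applied to W by leaving out one point. Let T_k be the part of W that involves X_k,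
so that ∑ T_k = 2W. Given the other points, T_k has mean zero, and by the projection identity its
conditional variance is a multiple of the same quadratic form on those points. Expanding around W −
T_k yields E[W g(W)] ≈ E[τ g'(W)], where τ is half the sum of the conditional variances. This τ is
affine in the off-diagonal and diagonal sums (`sum_kernelForm_erase`), so second moments show that
it concentrates at 1.

The Taylor remainder is where the other hypotheses enter. Classes with 1/p > Km are a small fraction
of all classes by the (1+δ)-moment bound, and second moments suffice there. On the remaining classes
fourth moments produce K²m/n² and K/n, which vanish because n/√m → ∞.

With trigonometric g, Stein's equation says that y(s) = E sin(sW+θ) nearly solves y' = −s y, so y(t)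
≈ sin θ · exp(−t²/2). The phases π/2 and 0 recover the characteristic function, and Lévy's
continuity theorem concludes. -/

theorem sum_coord_update {ι α : Type*} [DecidableEq ι] (f : α → ℝ) {S : Finset ι} {k : ι}
    (hk : k ∉ S) (x : ι → α) (a : α) :
    ∑ l ∈ S, f (Function.update x k a l) = ∑ l ∈ S, f (x l) :=
  Finset.sum_congr rfl fun l hl => by
    rw [Function.update_of_ne]
    rintro rfl
    exact hk hl

/-! ### Expectations under finite product weights. -/

section ProductExpectation

variable {ι α : Type*} [Fintype ι] [DecidableEq ι] [Fintype α]

/-- Expectation of `F` under the product of `ι` copies of the weights `p` on a finite set. -/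
def prodExp (p : α → ℝ) (F : (ι → α) → ℝ) : ℝ := ∑ x, (∏ k, p (x k)) * F x

variable {p : α → ℝ}

theorem prodExp_add (F G : (ι → α) → ℝ) :
    prodExp p (fun x => F x + G x) = prodExp p F + prodExp p G := by
  simp [prodExp, mul_add, Finset.sum_add_distrib]

theorem prodExp_sub (F G : (ι → α) → ℝ) :
    prodExp p (fun x => F x - G x) = prodExp p F - prodExp p G := by
  simp [prodExp, mul_sub, Finset.sum_sub_distrib]

theorem prodExp_const_mul (c : ℝ) (F : (ι → α) → ℝ) :
    prodExp p (fun x => c * F x) = c * prodExp p F := by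
  simp only [prodExp, Finset.mul_sum]
  exact Finset.sum_congr rfl fun _ _ => by ring

theorem prodExp_sum {κ : Type*} (s : Finset κ) (F : κ → (ι → α) → ℝ) :
    prodExp p (fun x => ∑ k ∈ s, F k x) = ∑ k ∈ s, prodExp p (F k) := by
  simp only [prodExp, Finset.mul_sum]
  exact Finset.sum_comm

theorem prodExp_mono (hp : ∀ a, 0 ≤ p a) {F G : (ι → α) → ℝ} (h : ∀ x, F x ≤ G x) :
    prodExp p F ≤ prodExp p G :=
  Finset.sum_le_sum fun x _ =>
    mul_le_mul_of_nonneg_left (h x) (Finset.prod_nonneg fun k _ => hp (x k))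

theorem prodExp_abs_le (hp : ∀ a, 0 ≤ p a) (F : (ι → α) → ℝ) :
    |prodExp p F| ≤ prodExp p (fun x => |F x|) := by
  refine (Finset.abs_sum_le_sum_abs _ _).trans_eq (Finset.sum_congr rfl fun x _ => ?_)
  rw [abs_mul, abs_of_nonneg (Finset.prod_nonneg fun k _ => hp (x k))]

theorem prodExp_const (hs : ∑ a, p a = 1) (c : ℝ) :
    prodExp p (fun _ : ι → α => c) = c := by
  rw [prodExp, ← Finset.sum_mul]
  have := (Finset.prod_univ_sum (fun _ : ι => (Finset.univ : Finset α)) (fun _ a => p a))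
  simp only [Fintype.piFinset_univ] at this
  rw [← this, hs]
  simp

/-- Integrating out one coordinate. -/
theorem prodExp_update (hs : ∑ a, p a = 1) (k : ι) (F : (ι → α) → ℝ) :
    prodExp p F = prodExp p (fun x => ∑ a, p a * F (Function.update x k a)) := by
  have key : ∀ (x : ι → α) (a : α),
      (∏ j, p (Function.update x k a j)) * p (x k) = (∏ j, p (x j)) * p a := by
    intro x a
    rw [← Finset.mul_prod_erase _ _ (Finset.mem_univ k),
      ← Finset.mul_prod_erase _ (fun j => p (x j)) (Finset.mem_univ k)]
    have : ∏ j ∈ Finset.univ.erase k, p (Function.update x k a j)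
        = ∏ j ∈ Finset.univ.erase k, p (x j) :=
      Finset.prod_congr rfl fun j hj => by
        rw [Function.update_of_ne (Finset.ne_of_mem_erase hj)]
    rw [this, Function.update_self]
    ring
  have h1 : prodExp p F = ∑ z : (ι → α) × α, ((∏ j, p (z.1 j)) * p z.2) * F z.1 := by
    rw [Fintype.sum_prod_type, prodExp]
    refine Finset.sum_congr rfl fun x _ => ?_
    simp only
    rw [← Finset.sum_mul, ← Finset.mul_sum, hs, mul_one]
  have h2 : prodExp p (fun x => ∑ a, p a * F (Function.update x k a))
      = ∑ z : (ι → α) × α, ((∏ j, p (z.1 j)) * p z.2) * F (Function.update z.1 k z.2) := by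
    rw [Fintype.sum_prod_type, prodExp]
    refine Finset.sum_congr rfl fun x _ => ?_
    rw [Finset.mul_sum]
    exact Finset.sum_congr rfl fun a _ => by ring
  rw [h1, h2]
  -- Exchanging coordinate k with an independent fresh copy is an involution that preserves the
  -- joint weight.
  have inv : ∀ z : (ι → α) × α,
      (Function.update (Function.update z.1 k z.2) k (z.1 k), (Function.update z.1 k z.2) k) = z := by
    rintro ⟨x, a⟩
    simp
  refine (Finset.sum_nbij' (fun z => (Function.update z.1 k z.2, z.1 k))
    (fun z => (Function.update z.1 k z.2, z.1 k)) (by simp) (by simp)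
    (fun z _ => inv z) (fun z _ => inv z) ?_).symm
  rintro ⟨x, a⟩ _
  simp only
  rw [key]

/-- Fubini for a factor that does not depend on the coordinate `k`. -/
theorem prodExp_mul_of_indep (hs : ∑ a, p a = 1) (k : ι) {A B : (ι → α) → ℝ}
    (hA : ∀ x a, A (Function.update x k a) = A x) :
    prodExp p (fun x => A x * B x)
      = prodExp p (fun x => A x * ∑ a, p a * B (Function.update x k a)) := by
  rw [prodExp_update hs k]
  congr 1
  ext x
  rw [Finset.mul_sum]
  exact Finset.sum_congr rfl fun a _ => by rw [hA]; ring

theorem prodExp_mul_coord (hs : ∑ a, p a = 1) (k : ι) {A : (ι → α) → ℝ} (f : α → ℝ)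
    (hA : ∀ x a, A (Function.update x k a) = A x) :
    prodExp p (fun x => A x * f (x k)) = prodExp p A * ∑ a, p a * f a := by
  rw [prodExp_mul_of_indep hs k hA]
  simp only [Function.update_self]
  rw [mul_comm, ← prodExp_const_mul]
  congr 1
  ext x
  ring

theorem prodExp_coord (hs : ∑ a, p a = 1) (k : ι) (f : α → ℝ) :
    prodExp p (fun x : ι → α => f (x k)) = ∑ a, p a * f a := by
  have := prodExp_mul_coord hs k (A := fun _ => 1) f (fun _ _ => rfl)
  simpa [prodExp_const hs] using this

theorem prodExp_sum_coord (hs : ∑ a, p a = 1) (S : Finset ι) {f : α → ℝ}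
    (hf : ∑ a, p a * f a = 0) :
    prodExp p (fun x : ι → α => ∑ l ∈ S, f (x l)) = 0 := by
  rw [prodExp_sum]
  exact Finset.sum_eq_zero fun l _ => by rw [prodExp_coord hs, hf]

theorem prodExp_sum_coord_sq (hs : ∑ a, p a = 1) (S : Finset ι) {f : α → ℝ}
    (hf : ∑ a, p a * f a = 0) :
    prodExp p (fun x : ι → α => (∑ l ∈ S, f (x l)) ^ 2) = S.card * ∑ a, p a * f a ^ 2 := by
  induction S using Finset.induction_on with
  | empty => simp [prodExp]
  | insert k S hk ih =>
    have e : (fun x : ι → α => (∑ l ∈ insert k S, f (x l)) ^ 2)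
        = fun x => ((∑ l ∈ S, f (x l)) ^ 2 + 2 * ((∑ l ∈ S, f (x l)) * f (x k))) + f (x k) ^ 2 := by
      ext x
      rw [Finset.sum_insert hk]
      ring
    rw [e, prodExp_add, prodExp_add, prodExp_const_mul, ih,
      prodExp_mul_coord hs k f (fun x a => sum_coord_update f hk x a), hf,
      prodExp_coord hs k (fun a => f a ^ 2), Finset.card_insert_of_notMem hk]
    push_cast
    ring

/-- Add one independent centred summand at a time: in the binomial expansion the terms linear in
either the new summand or the old sum vanish. -/
theorem prodExp_sum_coord_pow_four_le (hs : ∑ a, p a = 1) (S : Finset ι) {f : α → ℝ}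
    (hf : ∑ a, p a * f a = 0) :
    prodExp p (fun x : ι → α => (∑ l ∈ S, f (x l)) ^ 4)
      ≤ S.card * ∑ a, p a * f a ^ 4 + 3 * (S.card : ℝ) ^ 2 * (∑ a, p a * f a ^ 2) ^ 2 := by
  induction S using Finset.induction_on with
  | empty => simp [prodExp]
  | insert k S hk ih =>
    have hA := fun x a => sum_coord_update f hk x a
    have e : (fun x : ι → α => (∑ l ∈ insert k S, f (x l)) ^ 4)
        = fun x => ((((∑ l ∈ S, f (x l)) ^ 4 + 4 * ((∑ l ∈ S, f (x l)) ^ 3 * f (x k)))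
          + 6 * ((∑ l ∈ S, f (x l)) ^ 2 * f (x k) ^ 2))
          + 4 * ((∑ l ∈ S, f (x l)) * f (x k) ^ 3)) + f (x k) ^ 4 := by
      ext x
      rw [Finset.sum_insert hk]
      ring
    rw [e, prodExp_add, prodExp_add, prodExp_add, prodExp_add, prodExp_const_mul, prodExp_const_mul,
      prodExp_const_mul,
      prodExp_mul_coord hs k f (fun x a => by rw [hA x a]), hf,
      prodExp_mul_coord hs k (fun a => f a ^ 2) (fun x a => by rw [hA x a]),
      prodExp_mul_coord hs k (fun a => f a ^ 3) hA,
      prodExp_coord hs k (fun a => f a ^ 4), prodExp_sum_coord hs S hf,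
      prodExp_sum_coord_sq hs S hf, Finset.card_insert_of_notMem hk]
    push_cast
    -- With s = |S|, the cross term contributes 6s times this square, below the available 3((s+1)² −
    -- s²) = 6s + 3.
    have : 0 ≤ (∑ a, p a * f a ^ 2) ^ 2 := sq_nonneg _
    nlinarith

end ProductExpectation

/-! ### Elementary facts on the weights, and the diagonal part. -/

theorem one_le_inv_weight {α : Type*} [Fintype α] {p : α → ℝ}
    (hp : ∀ a, 0 < p a) (hs : ∑ a, p a = 1) (b : α) : 1 ≤ (p b)⁻¹ := by
  refine (one_le_inv₀ (hp b)).2 ?_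
  rw [← hs]
  exact Finset.single_le_sum (fun a _ => (hp a).le) (Finset.mem_univ b)

theorem sum_mul_inv_sub_card {α : Type*} [Fintype α] {p : α → ℝ}
    (hp : ∀ a, 0 < p a) (hs : ∑ a, p a = 1) :
    ∑ a, p a * ((p a)⁻¹ - Fintype.card α) = 0 := by
  simp only [mul_sub, mul_inv_cancel₀ (hp _).ne', Finset.sum_sub_distrib, ← Finset.sum_mul, hs]
  simp

/-- An empty sum is 0, so normalization alone forces at least one class. -/
theorem one_le_card_of_sum_eq_one {α : Type*} [Fintype α] {p : α → ℝ}
    (hs : ∑ a, p a = 1) : (1 : ℝ) ≤ Fintype.card α := by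
  rcases isEmpty_or_nonempty α with h | h
  · simp at hs
  · exact_mod_cast Fintype.card_pos

/-- The centred diagonal part of the quadratic form. -/
noncomputable def diagForm {ι α : Type*} [Fintype α] (p : α → ℝ) (S : Finset ι) (x : ι → α) : ℝ :=
  ∑ k ∈ S, ((p (x k))⁻¹ - Fintype.card α)

theorem prodExp_diagForm_sq {ι α : Type*} [Fintype ι] [DecidableEq ι] [Fintype α]
    {p : α → ℝ} (hp : ∀ a, 0 < p a) (hs : ∑ a, p a = 1) (S : Finset ι) :
    prodExp p (fun x => diagForm p S x ^ 2)
      = S.card * ∑ a, p a * ((p a)⁻¹ - Fintype.card α) ^ 2 := by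
  unfold diagForm
  exact prodExp_sum_coord_sq hs S (f := fun a => (p a)⁻¹ - Fintype.card α)
    (sum_mul_inv_sub_card hp hs)

/-! ### The Pearson kernel: projection identities and moments. -/

section PearsonKernel

variable {ι α : Type*} [DecidableEq α] (p : α → ℝ)

/-- The degenerate kernel whose quadratic form is Pearson's statistic. -/
noncomputable def pearsonKernel (a b : α) : ℝ := (if a = b then (p a)⁻¹ else 0) - 1

/-- The kernel summed over the sample points with index in `S`. -/
noncomputable def kernelSum (S : Finset ι) (b : α) (x : ι → α) : ℝ := ∑ l ∈ S, pearsonKernel p b (x l)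

/-- The full quadratic form of the kernel. -/
noncomputable def kernelForm (S : Finset ι) (x : ι → α) : ℝ := ∑ k ∈ S, kernelSum p S (x k) x

/-- The off-diagonal part of the quadratic form. -/
noncomputable def offDiagForm (S : Finset ι) (x : ι → α) : ℝ :=
  kernelForm p S x - ∑ k ∈ S, pearsonKernel p (x k) (x k)

variable {p}

theorem pearsonKernel_comm (a b : α) : pearsonKernel p a b = pearsonKernel p b a := by
  unfold pearsonKernel
  by_cases h : a = b
  · rw [h]
  · rw [if_neg h, if_neg (Ne.symm h)]

theorem pearsonKernel_self (a : α) : pearsonKernel p a a = (p a)⁻¹ - 1 := by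
  simp [pearsonKernel]

/-- A diagonal entry is 1/p − 1 = (1/p − m) + (m − 1), with m the number of classes and 1/p of mean
m. -/
theorem kernelForm_eq [Fintype α] (S : Finset ι) (x : ι → α) :
    kernelForm p S x
      = offDiagForm p S x + diagForm p S x + S.card * ((Fintype.card α : ℝ) - 1) := by
  simp only [offDiagForm, diagForm, pearsonKernel_self, Finset.sum_sub_distrib, Finset.sum_const,
    nsmul_eq_mul]
  ring

theorem offDiagForm_insert [DecidableEq ι] {S : Finset ι} {k : ι} (hk : k ∉ S) (x : ι → α) :
    offDiagForm p (insert k S) x = offDiagForm p S x + 2 * kernelSum p S (x k) x := by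
  simp only [offDiagForm, kernelForm, kernelSum, Finset.sum_insert hk, Finset.sum_add_distrib]
  have : ∑ l ∈ S, pearsonKernel p (x l) (x k) = ∑ l ∈ S, pearsonKernel p (x k) (x l) :=
    Finset.sum_congr rfl fun l _ => pearsonKernel_comm _ _
  rw [this]
  ring

section Update

variable [DecidableEq ι] {S : Finset ι} {k : ι}

theorem kernelSum_update (hk : k ∉ S) (b : α) (x : ι → α) (a : α) :
    kernelSum p S b (Function.update x k a) = kernelSum p S b x :=
  sum_coord_update _ hk x a

theorem kernelForm_update (hk : k ∉ S) (x : ι → α) (a : α) :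
    kernelForm p S (Function.update x k a) = kernelForm p S x := by
  simp only [kernelForm, kernelSum_update hk]
  exact sum_coord_update (fun b => kernelSum p S b x) hk x a

theorem offDiagForm_update (hk : k ∉ S) (x : ι → α) (a : α) :
    offDiagForm p S (Function.update x k a) = offDiagForm p S x := by
  rw [offDiagForm, kernelForm_update hk]
  exact congrArg _ (sum_coord_update (fun b => pearsonKernel p b b) hk x a)

end Update

section Orthogonality

variable [Fintype α]

theorem sum_mul_pearsonKernel (hp : ∀ a, 0 < p a) (hs : ∑ a, p a = 1) (b : α) :
    ∑ a, p a * pearsonKernel p b a = 0 := by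
  have e : ∀ a, p a * pearsonKernel p b a = (if b = a then 1 else 0) - p a := by
    intro a
    unfold pearsonKernel
    split_ifs with h
    · rw [h, mul_sub, mul_inv_cancel₀ (hp a).ne', mul_one]
    · ring
  simp [e, hs]

/-- Idempotence of the projection onto mean-zero functions; 1{a=b}/p(a) is the identity kernel for
the weights p. -/
theorem sum_mul_pearsonKernel_mul (hp : ∀ a, 0 < p a) (hs : ∑ a, p a = 1) (b c : α) :
    ∑ a, p a * (pearsonKernel p a b * pearsonKernel p a c) = pearsonKernel p b c := by
  have e : ∀ a, p a * (pearsonKernel p a b * pearsonKernel p a c)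
      = (if a = b then pearsonKernel p b c else 0) - p a * pearsonKernel p c a := by
    intro a
    rw [pearsonKernel_comm c a]
    split_ifs with h
    · rw [h, pearsonKernel_self]
      have := (hp b).ne'
      field_simp
    · rw [pearsonKernel, if_neg h]
      ring
  simp [e, sum_mul_pearsonKernel hp hs]

theorem sum_mul_pearsonKernel_sq (hp : ∀ a, 0 < p a) (hs : ∑ a, p a = 1) (b : α) :
    ∑ a, p a * pearsonKernel p b a ^ 2 = (p b)⁻¹ - 1 := by
  rw [← pearsonKernel_self, ← sum_mul_pearsonKernel_mul hp hs b b]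
  exact Finset.sum_congr rfl fun a _ => by rw [pearsonKernel_comm b a]; ring

/-- Since |h(b,·)| ≤ 1/p(b), two of the four factors can be taken out, leaving the second moment. -/
theorem sum_mul_pearsonKernel_pow_four_le (hp : ∀ a, 0 < p a) (hs : ∑ a, p a = 1) (b : α) :
    ∑ a, p a * pearsonKernel p b a ^ 4 ≤ (p b)⁻¹ ^ 3 := by
  have h1 := one_le_inv_weight hp hs b
  have key : ∀ a, pearsonKernel p b a ^ 4 ≤ (p b)⁻¹ ^ 2 * pearsonKernel p b a ^ 2 := by
    intro a
    have : pearsonKernel p b a ^ 2 ≤ (p b)⁻¹ ^ 2 := by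
      unfold pearsonKernel
      refine sq_le_sq' ?_ ?_ <;> split_ifs <;> linarith
    nlinarith [sq_nonneg (pearsonKernel p b a)]
  calc ∑ a, p a * pearsonKernel p b a ^ 4
      ≤ ∑ a, (p b)⁻¹ ^ 2 * (p a * pearsonKernel p b a ^ 2) :=
        Finset.sum_le_sum fun a _ => by nlinarith [key a, hp a]
    _ = (p b)⁻¹ ^ 2 * ((p b)⁻¹ - 1) := by rw [← Finset.mul_sum, sum_mul_pearsonKernel_sq hp hs]
    _ ≤ (p b)⁻¹ ^ 3 := by nlinarith

theorem sum_mul_kernelSum (hp : ∀ a, 0 < p a) (hs : ∑ a, p a = 1) (S : Finset ι) (x : ι → α) :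
    ∑ b, p b * kernelSum p S b x = 0 := by
  simp only [kernelSum, Finset.mul_sum]
  rw [Finset.sum_comm]
  refine Finset.sum_eq_zero fun l _ => ?_
  rw [← sum_mul_pearsonKernel hp hs (x l)]
  exact Finset.sum_congr rfl fun b _ => by rw [pearsonKernel_comm]

/-- The variance contributed by a fresh point, conditionally on the sample, is the quadratic form
itself. This closure makes the conditional variances computable; it also identifies Pearson's
statistic with the form. -/
theorem sum_mul_kernelSum_sq (hp : ∀ a, 0 < p a) (hs : ∑ a, p a = 1) (S : Finset ι) (x : ι → α) :
    ∑ b, p b * kernelSum p S b x ^ 2 = kernelForm p S x := by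
  simp only [kernelForm, kernelSum, sq, Finset.sum_mul_sum]
  simp only [Finset.mul_sum]
  rw [Finset.sum_comm]
  refine Finset.sum_congr rfl fun k _ => ?_
  rw [Finset.sum_comm]
  exact Finset.sum_congr rfl fun l _ => sum_mul_pearsonKernel_mul hp hs _ _

end Orthogonality

section Moments

variable [Fintype α] [Fintype ι] [DecidableEq ι]

/-- A function of one coordinate times the square of a kernel sum over the others. -/
theorem prodExp_mul_kernelSum_sq (hp : ∀ a, 0 < p a) (hs : ∑ a, p a = 1) {S : Finset ι} {k : ι}
    (hk : k ∉ S) (φ : α → ℝ) :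
    prodExp p (fun x => φ (x k) * kernelSum p S (x k) x ^ 2)
      = S.card * ∑ a, p a * (φ a * ((p a)⁻¹ - 1)) := by
  rw [prodExp_update hs k]
  simp only [Function.update_self, kernelSum_update hk]
  rw [prodExp_sum, Finset.mul_sum]
  refine Finset.sum_congr rfl fun a _ => ?_
  rw [prodExp_const_mul, prodExp_const_mul]
  unfold kernelSum
  rw [prodExp_sum_coord_sq hs S (sum_mul_pearsonKernel hp hs a), sum_mul_pearsonKernel_sq hp hs]
  ring

/-- Conditioning on the class of the point k leaves a sum of independent centred terms; the weight
p(a) then cancels one factor 1/p(a). -/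
theorem prodExp_mul_kernelSum_pow_four_le (hp : ∀ a, 0 < p a) (hs : ∑ a, p a = 1) {S : Finset ι}
    {k : ι} (hk : k ∉ S) {φ : α → ℝ} (hφ : ∀ a, 0 ≤ φ a) :
    prodExp p (fun x => φ (x k) * kernelSum p S (x k) x ^ 4)
      ≤ ∑ a, φ a * (S.card * (p a)⁻¹ ^ 2 + 3 * (S.card : ℝ) ^ 2 * (p a)⁻¹) := by
  rw [prodExp_update hs k]
  simp only [Function.update_self, kernelSum_update hk]
  rw [prodExp_sum]
  refine Finset.sum_le_sum fun a _ => ?_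
  rw [prodExp_const_mul, prodExp_const_mul]
  unfold kernelSum
  have h4 := prodExp_sum_coord_pow_four_le hs S (sum_mul_pearsonKernel hp hs a)
  rw [sum_mul_pearsonKernel_sq hp hs] at h4
  have h1 := one_le_inv_weight hp hs a
  have hS : (0 : ℝ) ≤ S.card := by positivity
  have hb : prodExp p (fun x : ι → α => (∑ l ∈ S, pearsonKernel p a (x l)) ^ 4)
      ≤ S.card * (p a)⁻¹ ^ 3 + 3 * (S.card : ℝ) ^ 2 * (p a)⁻¹ ^ 2 := by
    refine h4.trans ?_
    gcongr
    · exact sum_mul_pearsonKernel_pow_four_le hp hs a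
    · linarith
  calc p a * (φ a * prodExp p (fun x : ι → α => (∑ l ∈ S, pearsonKernel p a (x l)) ^ 4))
      ≤ p a * (φ a * (S.card * (p a)⁻¹ ^ 3 + 3 * (S.card : ℝ) ^ 2 * (p a)⁻¹ ^ 2)) := by
        gcongr
        · exact (hp a).le
        · exact hφ a
    _ = _ := by
        have := (hp a).ne'
        field_simp

theorem prodExp_mul_kernelSum_eq_zero (hp : ∀ a, 0 < p a) (hs : ∑ a, p a = 1) {S : Finset ι}
    {k : ι} (hk : k ∉ S) {A : (ι → α) → ℝ} (hA : ∀ x a, A (Function.update x k a) = A x) :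
    prodExp p (fun x => A x * kernelSum p S (x k) x) = 0 := by
  rw [prodExp_mul_of_indep hs k hA]
  simp only [Function.update_self, kernelSum_update hk, sum_mul_kernelSum hp hs, mul_zero,
    prodExp_const hs]

theorem prodExp_mul_kernelSum_sq_of_indep (hp : ∀ a, 0 < p a) (hs : ∑ a, p a = 1) {S : Finset ι}
    {k : ι} (hk : k ∉ S) {A : (ι → α) → ℝ} (hA : ∀ x a, A (Function.update x k a) = A x) :
    prodExp p (fun x => A x * kernelSum p S (x k) x ^ 2)
      = prodExp p (fun x => A x * kernelForm p S x) := by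
  rw [prodExp_mul_of_indep hs k hA]
  simp only [Function.update_self, kernelSum_update hk, sum_mul_kernelSum_sq hp hs]

theorem prodExp_offDiagForm (hp : ∀ a, 0 < p a) (hs : ∑ a, p a = 1) (S : Finset ι) :
    prodExp p (fun x => offDiagForm p S x) = 0 := by
  induction S using Finset.induction_on with
  | empty => simp [prodExp, offDiagForm, kernelForm]
  | insert k S hk ih =>
    have := prodExp_mul_kernelSum_eq_zero hp hs hk (A := fun _ => 2) (fun _ _ => rfl)
    simp only [offDiagForm_insert hk, prodExp_add, ih, this, add_zero]

theorem prodExp_kernelForm (hp : ∀ a, 0 < p a) (hs : ∑ a, p a = 1) (S : Finset ι) :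
    prodExp p (fun x => kernelForm p S x) = S.card * ((Fintype.card α : ℝ) - 1) := by
  have h : prodExp p (fun x : ι → α => diagForm p S x) = 0 :=
    prodExp_sum_coord hs S (sum_mul_inv_sub_card hp hs)
  simp only [kernelForm_eq, prodExp_add, prodExp_offDiagForm hp hs, h, prodExp_const hs]
  ring

/-- Adding points one at a time gives orthogonal martingale increments, of variance 4·|S|·(m − 1)
for m classes. -/
theorem prodExp_offDiagForm_sq_le (hp : ∀ a, 0 < p a) (hs : ∑ a, p a = 1) (S : Finset ι) :
    prodExp p (fun x => offDiagForm p S x ^ 2) ≤ 2 * (S.card : ℝ) ^ 2 * Fintype.card α := by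
  induction S using Finset.induction_on with
  | empty => simp [prodExp, offDiagForm, kernelForm]
  | insert k S hk ih =>
    have e : (fun x => offDiagForm p (insert k S) x ^ 2) = fun x =>
        (offDiagForm p S x ^ 2 + 4 * (offDiagForm p S x * kernelSum p S (x k) x))
          + 4 * kernelSum p S (x k) x ^ 2 := by
      ext x
      rw [offDiagForm_insert hk]
      ring
    have h2 := prodExp_mul_kernelSum_sq_of_indep hp hs hk (A := fun _ => 4) (fun _ _ => rfl)
    rw [prodExp_const_mul, prodExp_const_mul, prodExp_kernelForm hp hs] at h2
    rw [e, prodExp_add, prodExp_add, prodExp_const_mul,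
      prodExp_const_mul, prodExp_mul_kernelSum_eq_zero hp hs hk (offDiagForm_update hk), h2,
      Finset.card_insert_of_notMem hk]
    push_cast
    nlinarith [one_le_card_of_sum_eq_one hs, (Nat.cast_nonneg S.card : (0 : ℝ) ≤ S.card)]

theorem prodExp_kernelForm_sq_le (hp : ∀ a, 0 < p a) (hs : ∑ a, p a = 1) (S : Finset ι) :
    prodExp p (fun x => kernelForm p S x ^ 2)
      ≤ 3 * (2 * (S.card : ℝ) ^ 2 * Fintype.card α
        + S.card * ∑ a, p a * ((p a)⁻¹ - Fintype.card α) ^ 2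
        + (S.card * (Fintype.card α : ℝ)) ^ 2) := by
  have hm := one_le_card_of_sum_eq_one hs
  have hS : (0 : ℝ) ≤ S.card := by positivity
  calc prodExp p (fun x => kernelForm p S x ^ 2)
      ≤ prodExp p (fun x => 3 * ((offDiagForm p S x ^ 2 + diagForm p S x ^ 2)
        + (S.card * (Fintype.card α : ℝ)) ^ 2)) := by
        refine prodExp_mono (fun a => (hp a).le) fun x => ?_
        rw [kernelForm_eq]
        have : (S.card * ((Fintype.card α : ℝ) - 1)) ^ 2 ≤ (S.card * (Fintype.card α : ℝ)) ^ 2 := by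
          refine pow_le_pow_left₀ (mul_nonneg hS (by linarith)) ?_ 2
          gcongr
          linarith
        generalize (S.card * ((Fintype.card α : ℝ) - 1)) = c at *
        nlinarith [sq_nonneg (offDiagForm p S x - diagForm p S x),
          sq_nonneg (offDiagForm p S x - c), sq_nonneg (diagForm p S x - c)]
    _ ≤ _ := by
        rw [prodExp_const_mul, prodExp_add, prodExp_add, prodExp_const hs,
          prodExp_diagForm_sq hp hs]
        gcongr
        exact prodExp_offDiagForm_sq_le hp hs S

end Moments

end PearsonKernel

/-! ### Leave-one-out decomposition and Stein's equation. -/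

section Erase

variable {ι α : Type*} [Fintype ι] [DecidableEq ι] [DecidableEq α] {p : α → ℝ}

theorem offDiagForm_univ (k : ι) (x : ι → α) :
    offDiagForm p Finset.univ x = offDiagForm p (Finset.univ.erase k) x
      + 2 * kernelSum p (Finset.univ.erase k) (x k) x := by
  rw [← offDiagForm_insert (Finset.notMem_erase k _), Finset.insert_erase (Finset.mem_univ k)]

theorem sum_kernelSum_erase (x : ι → α) :
    ∑ k, kernelSum p (Finset.univ.erase k) (x k) x = offDiagForm p Finset.univ x := by
  rw [offDiagForm, kernelForm, ← Finset.sum_sub_distrib]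
  refine Finset.sum_congr rfl fun k _ => ?_
  simp only [kernelSum]
  rw [← Finset.add_sum_erase _ _ (Finset.mem_univ k)]
  ring

end Erase

section SteinBound

variable {ι α : Type*} [Fintype ι] [DecidableEq ι] [Fintype α] [DecidableEq α] {p : α → ℝ}

/-- Deleting each index in turn keeps every off-diagonal pair n − 2 times and every diagonal entry n
− 1 times, where n is the number of points. -/
theorem sum_kernelForm_erase (x : ι → α) :
    ∑ k, kernelForm p (Finset.univ.erase k) x
      = (Fintype.card ι - 2 : ℝ) * offDiagForm p Finset.univ x
        + (Fintype.card ι - 1 : ℝ) * diagForm p Finset.univ x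
        + Fintype.card ι * (Fintype.card ι - 1 : ℝ) * (Fintype.card α - 1 : ℝ) := by
  have e : ∀ k, kernelForm p (Finset.univ.erase k) x
      = (offDiagForm p Finset.univ x - 2 * kernelSum p (Finset.univ.erase k) (x k) x)
        + (diagForm p Finset.univ x - ((p (x k))⁻¹ - Fintype.card α))
        + (Fintype.card ι - 1 : ℝ) * (Fintype.card α - 1 : ℝ) := by
    intro k
    have hc : ((Finset.univ.erase k).card : ℝ) = Fintype.card ι - 1 := by
      rw [Finset.card_erase_of_mem (Finset.mem_univ k), Finset.card_univ,
        Nat.cast_sub (Fintype.card_pos_iff.2 ⟨k⟩), Nat.cast_one]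
    have hd : diagForm p (Finset.univ.erase k) x
        = diagForm p Finset.univ x - ((p (x k))⁻¹ - Fintype.card α) := by
      rw [diagForm, diagForm, ← Finset.add_sum_erase _ _ (Finset.mem_univ k)]
      ring
    rw [kernelForm_eq, hc, hd, offDiagForm_univ k]
    ring
  simp only [e, Finset.sum_add_distrib, Finset.sum_sub_distrib, ← Finset.mul_sum,
    sum_kernelSum_erase, Finset.sum_const, Finset.card_univ, nsmul_eq_mul]
  have hd : ∑ k, (p (x k))⁻¹ - Fintype.card ι * (Fintype.card α : ℝ)
      = diagForm p Finset.univ x := by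
    simp [diagForm, Finset.sum_sub_distrib]
  rw [hd]
  ring

/-- Leave-one-out expansion of `E[T g(W)]`, where `T` is the part of `W` that involves the
coordinate `k`. -/
theorem abs_prodExp_leaveOneOut_le (hp : ∀ a, 0 < p a) (hs : ∑ a, p a = 1) {c M ε : ℝ}
    (hε : 0 < ε) {g g' : ℝ → ℝ}
    (hlip : ∀ u v, |g' (u + v) - g' u| ≤ M * |v|)
    (htay : ∀ u v, |g (u + v) - g u - g' u * v| ≤ M * v ^ 2)
    (hlin : ∀ u v, |g (u + v) - g u - g' u * v| ≤ 2 * M * |v|)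
    (L : ℝ) (k : ι) :
    |prodExp p (fun x => c * kernelSum p (Finset.univ.erase k) (x k) x
          * g (c / 2 * offDiagForm p Finset.univ x))
        - prodExp p (fun x => c ^ 2 * kernelForm p (Finset.univ.erase k) x
          * g' (c / 2 * offDiagForm p Finset.univ x))|
      ≤ M * (2 * (c ^ 2 * prodExp p (fun x => (if (p (x k))⁻¹ ≤ L then 0 else 1)
              * kernelSum p (Finset.univ.erase k) (x k) x ^ 2))
          + 2 * ε * (c ^ 2 * prodExp p (fun x => 1
              * kernelSum p (Finset.univ.erase k) (x k) x ^ 2))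
          + c ^ 4 * (prodExp p (fun x => (if (p (x k))⁻¹ ≤ L then 1 else 0)
                * kernelSum p (Finset.univ.erase k) (x k) x ^ 4)
              + prodExp p (fun x => kernelForm p (Finset.univ.erase k) x ^ 2)) / ε) := by
  set S := Finset.univ.erase k with hSdef
  have hk : k ∉ S := Finset.notMem_erase k _
  have hM : 0 ≤ M := by simpa using (abs_nonneg _).trans (hlip 0 1)
  -- Both identities hold because W − T does not involve coordinate k. Subtracting these null
  -- expectations leaves T times a Taylor remainder, minus τ times an increment of g'.
  have z1 := prodExp_mul_kernelSum_eq_zero hp hs hk (A := fun x => c * g (c / 2 * offDiagForm p S x))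
    (fun x a => by rw [offDiagForm_update hk])
  have z2 := prodExp_mul_kernelSum_sq_of_indep hp hs hk
    (A := fun x => c ^ 2 * g' (c / 2 * offDiagForm p S x))
    (fun x a => by rw [offDiagForm_update hk])
  have e : prodExp p (fun x => c * kernelSum p S (x k) x
          * g (c / 2 * offDiagForm p Finset.univ x))
        - prodExp p (fun x => c ^ 2 * kernelForm p S x
          * g' (c / 2 * offDiagForm p Finset.univ x))
      = prodExp p (fun x => ((c * kernelSum p S (x k) x * g (c / 2 * offDiagForm p Finset.univ x)
          - c ^ 2 * kernelForm p S x * g' (c / 2 * offDiagForm p Finset.univ x))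
          - c * g (c / 2 * offDiagForm p S x) * kernelSum p S (x k) x)
          - (c ^ 2 * g' (c / 2 * offDiagForm p S x) * kernelSum p S (x k) x ^ 2
          - c ^ 2 * g' (c / 2 * offDiagForm p S x) * kernelForm p S x)) := by
    rw [prodExp_sub, prodExp_sub, prodExp_sub, prodExp_sub, z1, z2]
    ring
  rw [e]
  refine (prodExp_abs_le (fun a => (hp a).le) _).trans ?_
  refine (prodExp_mono (fun a => (hp a).le) (G := fun x =>
    M * ((2 * (c ^ 2 * ((if (p (x k))⁻¹ ≤ L then 0 else 1) * kernelSum p S (x k) x ^ 2))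
      + 2 * ε * (c ^ 2 * (1 * kernelSum p S (x k) x ^ 2)))
      + (c ^ 4 / ε) * ((if (p (x k))⁻¹ ≤ L then 1 else 0) * kernelSum p S (x k) x ^ 4
        + kernelForm p S x ^ 2))) fun x => ?_).trans_eq ?_
  · rw [offDiagForm_univ k, ← hSdef]
    set u := c / 2 * offDiagForm p S x
    set T := c * kernelSum p S (x k) x with hT
    set τ := c ^ 2 * kernelForm p S x with hτ
    have hu : c / 2 * (offDiagForm p S x + 2 * kernelSum p S (x k) x) = u + T := by
      simp only [u, hT]
      ring
    rw [hu]
    have e1 : ((T * g (u + T) - τ * g' (u + T)) - c * g u * kernelSum p S (x k) x)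
        - (c ^ 2 * g' u * kernelSum p S (x k) x ^ 2 - c ^ 2 * g' u * kernelForm p S x)
        = T * (g (u + T) - g u - g' u * T) - τ * (g' (u + T) - g' u) := by
      rw [hT, hτ]
      ring
    rw [e1]
    have b1 : |τ * (g' (u + T) - g' u)| ≤ M * (ε * T ^ 2 + τ ^ 2 / ε) := by
      rw [abs_mul]
      have : |τ| * |T| ≤ ε * T ^ 2 + τ ^ 2 / ε := by
        rw [← sq_abs T, ← sq_abs τ, ← sub_nonneg]
        have : ε * |T| ^ 2 + |τ| ^ 2 / ε - |τ| * |T|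
            = ((ε * |T| - |τ|) ^ 2 + |τ| * (ε * |T|)) / ε := by
          field_simp
          ring
        rw [this]
        positivity
      calc |τ| * |g' (u + T) - g' u| ≤ |τ| * (M * |T|) := by gcongr; exact hlip u T
        _ = M * (|τ| * |T|) := by ring
        _ ≤ _ := by gcongr
    -- For common classes the quadratic remainder gives |T|³, split into εT² + T⁴/ε. For rare
    -- classes the linear bound is used, so that no fourth moment is needed.
    have b2 : |T * (g (u + T) - g u - g' u * T)|
        ≤ M * (2 * ((if (p (x k))⁻¹ ≤ L then 0 else 1) * T ^ 2) + ε * T ^ 2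
          + (if (p (x k))⁻¹ ≤ L then 1 else 0) * T ^ 4 / ε) := by
      rw [abs_mul]
      split_ifs
      · have : |T| * T ^ 2 ≤ ε * T ^ 2 + T ^ 4 / ε := by
          rw [← sq_abs T, show T ^ 4 = |T| ^ 4 by rw [Even.pow_abs (by decide)], ← sub_nonneg]
          have : ε * |T| ^ 2 + |T| ^ 4 / ε - |T| * |T| ^ 2
              = |T| ^ 2 * ((ε - |T|) ^ 2 + ε * |T|) / ε := by
            field_simp
            ring
          rw [this]
          positivity
        calc |T| * |g (u + T) - g u - g' u * T| ≤ |T| * (M * T ^ 2) := by gcongr; exact htay u T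
          _ = M * (|T| * T ^ 2) := by ring
          _ ≤ M * (ε * T ^ 2 + T ^ 4 / ε) := by gcongr
          _ = _ := by ring
      · calc |T| * |g (u + T) - g u - g' u * T| ≤ |T| * (2 * M * |T|) := by gcongr; exact hlin u T
          _ = M * (2 * T ^ 2) := by rw [← sq_abs T]; ring
          _ ≤ _ := by
            gcongr
            have : 0 ≤ ε * T ^ 2 := by positivity
            rw [zero_mul, zero_div, one_mul]
            linarith
    calc |T * (g (u + T) - g u - g' u * T) - τ * (g' (u + T) - g' u)|
        ≤ |T * (g (u + T) - g u - g' u * T)| + |τ * (g' (u + T) - g' u)| := abs_sub _ _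
      _ ≤ _ := add_le_add b2 b1
      _ = _ := by
        rw [hT, hτ]
        ring
  · rw [prodExp_const_mul, prodExp_add, prodExp_add, prodExp_const_mul, prodExp_const_mul,
      prodExp_const_mul, prodExp_const_mul, prodExp_const_mul, prodExp_const_mul, prodExp_add]
    ring

theorem card_erase_le (k : ι) : ((Finset.univ.erase k).card : ℝ) ≤ Fintype.card ι := by
  exact_mod_cast Finset.card_le_univ _

/-- The conditional second moment is of order 1/p(a), which the weight p(a) cancels: classes are
counted, not weighted, so an indicator φ gives the number of classes. -/
theorem prodExp_leaveOneOut_sq_le (hp : ∀ a, 0 < p a) (hs : ∑ a, p a = 1) (k : ι) {φ : α → ℝ}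
    (hφ : ∀ a, 0 ≤ φ a) :
    prodExp p (fun x => φ (x k) * kernelSum p (Finset.univ.erase k) (x k) x ^ 2)
      ≤ Fintype.card ι * ∑ a, φ a := by
  rw [prodExp_mul_kernelSum_sq hp hs (Finset.notMem_erase k _)]
  have h0 : ∀ a, 0 ≤ (p a)⁻¹ - 1 := fun a => by linarith [one_le_inv_weight hp hs a]
  refine mul_le_mul (card_erase_le k) (Finset.sum_le_sum fun a _ => ?_)
    (Finset.sum_nonneg fun a _ => mul_nonneg (hp a).le (mul_nonneg (hφ a) (h0 a))) (by positivity)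
  have : p a * (φ a * ((p a)⁻¹ - 1)) = φ a - p a * φ a := by
    have := (hp a).ne'
    field_simp
  rw [this]
  linarith [mul_nonneg (hp a).le (hφ a)]

theorem prodExp_leaveOneOut_pow_four_le (hp : ∀ a, 0 < p a) (hs : ∑ a, p a = 1) (k : ι) {L : ℝ}
    (hL : 0 ≤ L) :
    prodExp p (fun x => (if (p (x k))⁻¹ ≤ L then 1 else 0)
        * kernelSum p (Finset.univ.erase k) (x k) x ^ 4)
      ≤ Fintype.card α * (Fintype.card ι * L ^ 2 + 3 * (Fintype.card ι : ℝ) ^ 2 * L) := by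
  refine (prodExp_mul_kernelSum_pow_four_le hp hs (Finset.notMem_erase k _)
    (φ := fun a => if (p a)⁻¹ ≤ L then 1 else 0) (fun a => by positivity)).trans ?_
  refine (Finset.sum_le_card_nsmul _ _
    (Fintype.card ι * L ^ 2 + 3 * (Fintype.card ι : ℝ) ^ 2 * L) fun a _ => ?_).trans_eq ?_
  · have hi : 0 < (p a)⁻¹ := inv_pos.2 (hp a)
    split_ifs with h
    · rw [one_mul]
      have := card_erase_le k
      gcongr
    · rw [zero_mul]
      positivity
  · rw [nsmul_eq_mul, Finset.card_univ]

/-- The averaged conditional variance is close to `1`. -/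
theorem prodExp_condVariance_sub_one_sq_le [Nonempty ι] (hp : ∀ a, 0 < p a) (hs : ∑ a, p a = 1)
    {c : ℝ} (hc : c ^ 2 = 2 / ((Fintype.card ι : ℝ) ^ 2 * Fintype.card α)) :
    prodExp p (fun x : ι → α =>
        (c ^ 2 / 2 * ∑ k, kernelForm p (Finset.univ.erase k) x - 1) ^ 2)
      ≤ 3 * (2 / Fintype.card α
        + (∑ a, p a * ((p a)⁻¹ - Fintype.card α) ^ 2) / (Fintype.card ι * (Fintype.card α : ℝ) ^ 2)
        + (1 / Fintype.card ι + 1 / Fintype.card α) ^ 2) := by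
  have hJ := prodExp_offDiagForm_sq_le hp hs (Finset.univ : Finset ι)
  have hG := prodExp_diagForm_sq hp hs (Finset.univ : Finset ι)
  have hn : (1 : ℝ) ≤ Fintype.card ι := by exact_mod_cast Fintype.card_pos
  have hm := one_le_card_of_sum_eq_one hs
  simp only [sum_kernelForm_erase, hc]
  rw [Finset.card_univ] at hJ hG
  set n : ℝ := (Fintype.card ι : ℝ)
  set m : ℝ := (Fintype.card α : ℝ)
  set V := ∑ a, p a * ((p a)⁻¹ - m) ^ 2
  have hn0 : 0 < n := by linarith
  have hm0 : 0 < m := by linarith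
  calc prodExp p (fun x : ι → α => (2 / (n ^ 2 * m) / 2 * ((n - 2) * offDiagForm p Finset.univ x
        + (n - 1) * diagForm p Finset.univ x + n * (n - 1) * (m - 1)) - 1) ^ 2)
      ≤ prodExp p (fun x : ι → α => 3 * ((1 / (n * m) ^ 2 * offDiagForm p Finset.univ x ^ 2
        + 1 / (n * m) ^ 2 * diagForm p Finset.univ x ^ 2) + (1 / n + 1 / m) ^ 2)) := by
        refine prodExp_mono (fun a => (hp a).le) fun x => ?_
        -- The deterministic part is (1 − 1/n)(1 − 1/m) − 1; the coefficients of J/(nm) and G/(nm)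
        -- have absolute value at most 1, already for n = 1.
        set J := offDiagForm p Finset.univ x
        set G := diagForm p Finset.univ x
        have e : 2 / (n ^ 2 * m) / 2 * ((n - 2) * J + (n - 1) * G + n * (n - 1) * (m - 1)) - 1
            = (n - 2) / n * (J / (n * m)) + (n - 1) / n * (G / (n * m))
              + -(1 / n + 1 / m - 1 / (n * m)) := by
          field_simp
          ring
        have h1 : ((n - 2) / n * (J / (n * m))) ^ 2 ≤ 1 / (n * m) ^ 2 * J ^ 2 := by
          have : ((n - 2) / n) ^ 2 ≤ 1 := by
            rw [sq_le_one_iff_abs_le_one, abs_le]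
            constructor
            · rw [le_div_iff₀ hn0]
              linarith
            · rw [div_le_iff₀ hn0]
              linarith
          calc ((n - 2) / n * (J / (n * m))) ^ 2 = ((n - 2) / n) ^ 2 * (J / (n * m)) ^ 2 := by ring
            _ ≤ 1 * (J / (n * m)) ^ 2 := by gcongr
            _ = _ := by ring
        have h2 : ((n - 1) / n * (G / (n * m))) ^ 2 ≤ 1 / (n * m) ^ 2 * G ^ 2 := by
          have : ((n - 1) / n) ^ 2 ≤ 1 := by
            rw [sq_le_one_iff_abs_le_one, abs_le]
            constructor
            · rw [le_div_iff₀ hn0]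
              linarith
            · rw [div_le_iff₀ hn0]
              linarith
          calc ((n - 1) / n * (G / (n * m))) ^ 2 = ((n - 1) / n) ^ 2 * (G / (n * m)) ^ 2 := by ring
            _ ≤ 1 * (G / (n * m)) ^ 2 := by gcongr
            _ = _ := by ring
        have h3 : (-(1 / n + 1 / m - 1 / (n * m))) ^ 2 ≤ (1 / n + 1 / m) ^ 2 := by
          rw [neg_sq]
          have a1 : 0 < 1 / (n * m) := by positivity
          have a2 : 1 / (n * m) ≤ 1 / n := by
            gcongr
            nlinarith
          have a3 : 0 < 1 / m := by positivity
          exact pow_le_pow_left₀ (by linarith) (by linarith) 2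
        rw [e]
        generalize (n - 2) / n * (J / (n * m)) = A at *
        generalize (n - 1) / n * (G / (n * m)) = B at *
        generalize -(1 / n + 1 / m - 1 / (n * m)) = C at *
        nlinarith [sq_nonneg (A - B), sq_nonneg (A - C), sq_nonneg (B - C)]
    _ ≤ _ := by
        rw [prodExp_const_mul, prodExp_add, prodExp_add, prodExp_const hs, prodExp_const_mul,
          prodExp_const_mul, hG]
        gcongr
        · calc 1 / (n * m) ^ 2 * prodExp p (fun x : ι → α => offDiagForm p Finset.univ x ^ 2)
              ≤ 1 / (n * m) ^ 2 * (2 * n ^ 2 * m) := by gcongr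
            _ = 2 / m := by field_simp
        · refine le_of_eq ?_
          field_simp

/-- Stein's equation for the normalized off-diagonal form, with an explicit error. -/
theorem abs_prodExp_stein_le [Nonempty ι] (hp : ∀ a, 0 < p a) (hs : ∑ a, p a = 1) {c M ε K : ℝ}
    (hc : c ^ 2 = 2 / ((Fintype.card ι : ℝ) ^ 2 * Fintype.card α))
    (hε : 0 < ε) (hK : 0 ≤ K) {g g' : ℝ → ℝ}
    (hbd : ∀ u, |g' u| ≤ M)
    (hlip : ∀ u v, |g' (u + v) - g' u| ≤ M * |v|)
    (htay : ∀ u v, |g (u + v) - g u - g' u * v| ≤ M * v ^ 2)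
    (hlin : ∀ u v, |g (u + v) - g u - g' u * v| ≤ 2 * M * |v|)
    {n m b V : ℝ} (hn : n = Fintype.card ι) (hm : m = Fintype.card α)
    (hb : b = ∑ a, if (p a)⁻¹ ≤ K * m then (0 : ℝ) else 1)
    (hV : V = ∑ a, p a * ((p a)⁻¹ - m) ^ 2) :
    |prodExp p (fun x : ι → α => c / 2 * offDiagForm p Finset.univ x
          * g (c / 2 * offDiagForm p Finset.univ x))
        - prodExp p (fun x : ι → α => g' (c / 2 * offDiagForm p Finset.univ x))|
      ≤ M * (2 * (b / m) + 3 * ε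
        + (2 * K ^ 2 * (m / n ^ 2) + 6 * K / n + 12 / (n * m) + 6 * V / (n * m) ^ 2 + 6 / n
          + 3 * (2 / m + V / (n * m ^ 2) + (1 / n + 1 / m) ^ 2)) / ε) := by
  have hn1 : (1 : ℝ) ≤ n := by rw [hn]; exact_mod_cast Fintype.card_pos
  have hm1 : 1 ≤ m := hm ▸ one_le_card_of_sum_eq_one hs
  have hn0 : 0 < n := by linarith
  have hm0 : 0 < m := by linarith
  have hV0 : 0 ≤ V := hV ▸ Finset.sum_nonneg fun a _ => mul_nonneg (hp a).le (sq_nonneg _)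
  have hM : 0 ≤ M := (abs_nonneg _).trans (hbd 0)
  have hD := prodExp_condVariance_sub_one_sq_le (ι := ι) hp hs hc
  rw [← hn, ← hm, ← hV] at hD
  rw [← hn, ← hm] at hc
  have hk : ∀ k : ι, |prodExp p (fun x => c * kernelSum p (Finset.univ.erase k) (x k) x
          * g (c / 2 * offDiagForm p Finset.univ x))
        - prodExp p (fun x => c ^ 2 * kernelForm p (Finset.univ.erase k) x
          * g' (c / 2 * offDiagForm p Finset.univ x))|
      ≤ M * (2 * (c ^ 2 * (n * b)) + 2 * ε * (c ^ 2 * (n * m))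
        + c ^ 4 * (m * (n * (K * m) ^ 2 + 3 * n ^ 2 * (K * m))
          + 3 * (2 * n ^ 2 * m + n * V + (n * m) ^ 2)) / ε) := by
    intro k
    refine (abs_prodExp_leaveOneOut_le hp hs hε hlip htay hlin (K * m) k).trans ?_
    have q1 := prodExp_leaveOneOut_sq_le hp hs k
      (φ := fun a => if (p a)⁻¹ ≤ K * m then 0 else 1) (fun a => by positivity)
    have q2 := prodExp_leaveOneOut_sq_le hp hs k (φ := fun _ => 1) (fun _ => zero_le_one)
    have q3 := prodExp_leaveOneOut_pow_four_le hp hs k (L := K * m) (by positivity)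
    have q4 := prodExp_kernelForm_sq_le hp hs (Finset.univ.erase k)
    have hcard := card_erase_le k
    rw [Finset.sum_const, Finset.card_univ, nsmul_eq_mul, mul_one, ← hm] at q2
    rw [← hn] at q1 q2 q3 hcard
    rw [← hm] at q3 q4
    rw [← hb] at q1
    rw [← hV] at q4
    have q5 : prodExp p (fun x => kernelForm p (Finset.univ.erase k) x ^ 2)
        ≤ 3 * (2 * n ^ 2 * m + n * V + (n * m) ^ 2) := by
      refine q4.trans ?_
      gcongr
    gcongr
  -- The factor 1/2 appears because every off-diagonal pair involves two of the left-out
  -- coordinates.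
  have hW : prodExp p (fun x : ι → α => c / 2 * offDiagForm p Finset.univ x
          * g (c / 2 * offDiagForm p Finset.univ x))
      = 1 / 2 * ∑ k : ι, prodExp p (fun x => c * kernelSum p (Finset.univ.erase k) (x k) x
          * g (c / 2 * offDiagForm p Finset.univ x)) := by
    rw [← prodExp_sum, ← prodExp_const_mul]
    congr 1
    ext x
    rw [← Finset.sum_mul, ← Finset.mul_sum, sum_kernelSum_erase]
    ring
  have hτ : prodExp p (fun x : ι → α =>
        (c ^ 2 / 2 * ∑ k : ι, kernelForm p (Finset.univ.erase k) x - 1)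
          * g' (c / 2 * offDiagForm p Finset.univ x))
      = 1 / 2 * ∑ k : ι, prodExp p (fun x => c ^ 2 * kernelForm p (Finset.univ.erase k) x
          * g' (c / 2 * offDiagForm p Finset.univ x))
        - prodExp p (fun x : ι → α => g' (c / 2 * offDiagForm p Finset.univ x)) := by
    rw [← prodExp_sum, ← prodExp_const_mul, ← prodExp_sub]
    congr 1
    ext x
    rw [← Finset.sum_mul, ← Finset.mul_sum]
    ring
  have hτb : |prodExp p (fun x : ι → α =>
        (c ^ 2 / 2 * ∑ k : ι, kernelForm p (Finset.univ.erase k) x - 1)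
          * g' (c / 2 * offDiagForm p Finset.univ x))|
      ≤ M * (ε + 3 * (2 / m + V / (n * m ^ 2) + (1 / n + 1 / m) ^ 2) / ε) := by
    refine (prodExp_abs_le (fun a => (hp a).le) _).trans ?_
    refine (prodExp_mono (fun a => (hp a).le) (G := fun x : ι → α => M * (ε + 1 / ε *
      (c ^ 2 / 2 * ∑ k : ι, kernelForm p (Finset.univ.erase k) x - 1) ^ 2)) fun x => ?_).trans ?_
    · generalize c ^ 2 / 2 * ∑ k : ι, kernelForm p (Finset.univ.erase k) x - 1 = Y
      have hY : |Y| ≤ ε + 1 / ε * Y ^ 2 := by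
        rw [← sq_abs Y, ← sub_nonneg]
        have : ε + 1 / ε * |Y| ^ 2 - |Y| = ((ε - |Y|) ^ 2 + ε * |Y|) / ε := by
          field_simp
          ring
        rw [this]
        positivity
      rw [abs_mul, mul_comm]
      gcongr
      exact hbd _
    · rw [prodExp_const_mul, prodExp_add, prodExp_const hs, prodExp_const_mul]
      gcongr
      rw [one_div, inv_mul_eq_div]
      gcongr
  have hsum : |∑ k : ι, (prodExp p (fun x => c * kernelSum p (Finset.univ.erase k) (x k) x
          * g (c / 2 * offDiagForm p Finset.univ x))
        - prodExp p (fun x => c ^ 2 * kernelForm p (Finset.univ.erase k) x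
          * g' (c / 2 * offDiagForm p Finset.univ x)))|
      ≤ n * (M * (2 * (c ^ 2 * (n * b)) + 2 * ε * (c ^ 2 * (n * m))
        + c ^ 4 * (m * (n * (K * m) ^ 2 + 3 * n ^ 2 * (K * m))
          + 3 * (2 * n ^ 2 * m + n * V + (n * m) ^ 2)) / ε)) := by
    refine (Finset.abs_sum_le_sum_abs _ _).trans ((Finset.sum_le_card_nsmul _ _ _
      fun k _ => hk k).trans_eq ?_)
    rw [nsmul_eq_mul, Finset.card_univ, hn]
  rw [Finset.sum_sub_distrib] at hsum
  have hc4 : c ^ 4 = (2 / (n ^ 2 * m)) ^ 2 := by rw [← hc]; ring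
  have hfin : 1 / 2 * (n * (M * (2 * (c ^ 2 * (n * b)) + 2 * ε * (c ^ 2 * (n * m))
        + c ^ 4 * (m * (n * (K * m) ^ 2 + 3 * n ^ 2 * (K * m))
          + 3 * (2 * n ^ 2 * m + n * V + (n * m) ^ 2)) / ε)))
        + M * (ε + 3 * (2 / m + V / (n * m ^ 2) + (1 / n + 1 / m) ^ 2) / ε)
      = M * (2 * (b / m) + 3 * ε
        + (2 * K ^ 2 * (m / n ^ 2) + 6 * K / n + 12 / (n * m) + 6 * V / (n * m) ^ 2 + 6 / n
          + 3 * (2 / m + V / (n * m ^ 2) + (1 / n + 1 / m) ^ 2)) / ε) := by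
    rw [hc4, hc]
    field_simp
    ring
  rw [← hfin, hW]
  rw [hτ] at hτb
  rw [abs_le] at hsum hτb ⊢
  constructor <;> linarith [hsum.1, hsum.2, hτb.1, hτb.2]

end SteinBound

/-! ### From Stein's equation to trigonometric moments. -/

/-- Approximate solutions of the equation satisfied by `exp (-s ^ 2 / 2)` are close to multiples of the Gaussian. -/
theorem abs_sub_mul_exp_le_of_approx_ode {y y' : ℝ → ℝ} {R t : ℝ}
    (hy : ∀ s, HasDerivAt y (y' s) s) (hR : ∀ s, |s| ≤ |t| → |y' s + s * y s| ≤ R) :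
    |y t - y 0 * Real.exp (-t ^ 2 / 2)| ≤ R * |t| := by
  -- Integrating factor exp(s²/2); the mean value inequality on [−|t|, |t|] then treats both signs
  -- of t at once.
  have hz : ∀ s, HasDerivAt (fun s => y s * Real.exp (s ^ 2 / 2))
      ((y' s + s * y s) * Real.exp (s ^ 2 / 2)) s := by
    intro s
    have h1 : HasDerivAt (fun s : ℝ => s ^ 2 / 2) s s := by
      have := ((hasDerivAt_id s).pow 2).div_const 2
      simpa using this
    refine ((hy s).mul h1.exp).congr_deriv ?_
    ring
  have hb : ∀ s ∈ Set.Icc (-|t|) |t|,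
      ‖(y' s + s * y s) * Real.exp (s ^ 2 / 2)‖ ≤ R * Real.exp (t ^ 2 / 2) := by
    intro s hs
    have hs' : |s| ≤ |t| := abs_le.2 hs
    have hR0 : 0 ≤ R := (abs_nonneg _).trans (hR s hs')
    rw [norm_mul, Real.norm_eq_abs, Real.norm_eq_abs, Real.abs_exp]
    have := sq_le_sq.2 hs'
    gcongr
    exact hR s hs'
  have key := (convex_Icc (-|t|) |t|).norm_image_sub_le_of_norm_hasDerivWithin_le
    (fun s _ => (hz s).hasDerivWithinAt) hb (x := 0) (y := t)
    (by simp) ⟨neg_abs_le t, le_abs_self t⟩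
  simp only [Real.norm_eq_abs, sub_zero] at key
  have e : y t - y 0 * Real.exp (-t ^ 2 / 2)
      = (y t * Real.exp (t ^ 2 / 2) - y 0 * Real.exp (0 ^ 2 / 2)) * Real.exp (-t ^ 2 / 2) := by
    have h0 : Real.exp (t ^ 2 / 2) * Real.exp (-t ^ 2 / 2) = 1 := by
      rw [← Real.exp_add, ← Real.exp_zero]
      congr 1
      ring
    have h1 : Real.exp ((0 : ℝ) ^ 2 / 2) = 1 := by simp
    rw [h1, sub_mul, mul_assoc, h0]
    ring
  rw [e, abs_mul, Real.abs_exp]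
  calc |y t * Real.exp (t ^ 2 / 2) - y 0 * Real.exp (0 ^ 2 / 2)| * Real.exp (-t ^ 2 / 2)
      ≤ R * Real.exp (t ^ 2 / 2) * |t| * Real.exp (-t ^ 2 / 2) := by gcongr
    _ = R * |t| * (Real.exp (t ^ 2 / 2) * Real.exp (-t ^ 2 / 2)) := by ring
    _ = R * |t| := by
      rw [← Real.exp_add, show t ^ 2 / 2 + -t ^ 2 / 2 = 0 by ring, Real.exp_zero, mul_one]

theorem abs_sin_add_sub_le (a b : ℝ) : |Real.sin (a + b) - Real.sin a - Real.cos a * b| ≤ b ^ 2 := by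
  have hz : ∀ s, HasDerivAt (fun s => Real.sin (a + s) - Real.cos a * s)
      (Real.cos (a + s) - Real.cos a) s := by
    intro s
    have h1 : HasDerivAt (fun s => a + s) 1 s := (hasDerivAt_id s).const_add a
    refine (h1.sin.sub ((hasDerivAt_id s).const_mul (Real.cos a))).congr_deriv ?_
    simp
  have hb : ∀ s ∈ Set.Icc (-|b|) |b|, ‖Real.cos (a + s) - Real.cos a‖ ≤ |b| := by
    intro s hs
    refine (Real.abs_cos_sub_cos_le _ _).trans ?_
    simpa using abs_le.2 hs
  have key := (convex_Icc (-|b|) |b|).norm_image_sub_le_of_norm_hasDerivWithin_le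
    (fun s _ => (hz s).hasDerivWithinAt) hb (x := 0) (y := b)
    (by simp) ⟨neg_abs_le b, le_abs_self b⟩
  simp only [Real.norm_eq_abs, sub_zero, add_zero, mul_zero] at key
  rw [← sq_abs b, sq]
  convert key using 2
  ring

theorem abs_sin_add_sub_le_linear (a b : ℝ) :
    |Real.sin (a + b) - Real.sin a - Real.cos a * b| ≤ 2 * |b| := by
  have h1 : |Real.sin (a + b) - Real.sin a| ≤ |b| := by
    simpa using Real.abs_sin_sub_sin_le (a + b) a
  have h2 : |Real.cos a * b| ≤ |b| := by
    rw [abs_mul]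
    exact mul_le_of_le_one_left (abs_nonneg b) (Real.abs_cos_le_one a)
  linarith [abs_sub (Real.sin (a + b) - Real.sin a) (Real.cos a * b)]

theorem hasDerivAt_prodExp_sin {ι α : Type*} [Fintype ι] [DecidableEq ι] [Fintype α] {p : α → ℝ}
    (F : (ι → α) → ℝ) (θ s : ℝ) :
    HasDerivAt (fun s => prodExp p (fun x => Real.sin (s * F x + θ)))
      (prodExp p (fun x => F x * Real.cos (s * F x + θ))) s := by
  unfold prodExp
  refine HasDerivAt.fun_sum fun x _ => HasDerivAt.const_mul _ ?_
  have h1 : HasDerivAt (fun s => s * F x + θ) (F x) s := by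
    simpa using ((hasDerivAt_id s).mul_const (F x)).add_const θ
  exact h1.sin.congr_deriv (mul_comm _ _)

section Trigonometric

variable {ι α : Type*} [Fintype ι] [DecidableEq ι] [Fintype α] [DecidableEq α] {p : α → ℝ}

/-- The error in Stein's equation for the normalized off-diagonal form. -/
noncomputable def steinError (n m b V ε K : ℝ) : ℝ :=
  2 * (b / m) + 3 * ε
    + (2 * K ^ 2 * (m / n ^ 2) + 6 * K / n + 12 / (n * m) + 6 * V / (n * m) ^ 2 + 6 / n
      + 3 * (2 / m + V / (n * m ^ 2) + (1 / n + 1 / m) ^ 2)) / ε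

theorem abs_prodExp_stein_sin_le [Nonempty ι] (hp : ∀ a, 0 < p a) (hs : ∑ a, p a = 1) {c ε K : ℝ}
    (hc : c ^ 2 = 2 / ((Fintype.card ι : ℝ) ^ 2 * Fintype.card α))
    (hε : 0 < ε) (hK : 0 ≤ K)
    {n m b V : ℝ} (hn : n = Fintype.card ι) (hm : m = Fintype.card α)
    (hb : b = ∑ a, if (p a)⁻¹ ≤ K * m then (0 : ℝ) else 1)
    (hV : V = ∑ a, p a * ((p a)⁻¹ - m) ^ 2) (s θ : ℝ) :
    |prodExp p (fun x : ι → α => c / 2 * offDiagForm p Finset.univ x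
          * Real.sin (s * (c / 2 * offDiagForm p Finset.univ x) + θ))
        - prodExp p (fun x : ι → α => s * Real.cos (s * (c / 2 * offDiagForm p Finset.univ x) + θ))|
      ≤ (1 + s ^ 2) * steinError n m b V ε K := by
  -- The four bounds on the test function require |s| or s²; M = 1 + s² dominates both.
  have hs1 : |s| ≤ 1 + s ^ 2 := by
    rw [← sq_abs]
    nlinarith [sq_nonneg (|s| - 1)]
  have hs2 : |s| ^ 2 ≤ 1 + s ^ 2 := by rw [sq_abs]; linarith
  have shift : ∀ u v, s * (u + v) + θ = (s * u + θ) + s * v := fun u v => by ring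
  have lin : ∀ u v, Real.sin (s * (u + v) + θ) - Real.sin (s * u + θ) - s * Real.cos (s * u + θ) * v
      = Real.sin (s * u + θ + s * v) - Real.sin (s * u + θ) - Real.cos (s * u + θ) * (s * v) :=
    fun u v => by rw [shift]; ring
  refine abs_prodExp_stein_le hp hs hc hε hK (g := fun u => Real.sin (s * u + θ))
    (g' := fun u => s * Real.cos (s * u + θ)) (fun u => ?_) (fun u v => ?_) (fun u v => ?_)
    (fun u v => ?_) hn hm hb hV
  · rw [abs_mul]
    exact (mul_le_of_le_one_right (abs_nonneg s) (Real.abs_cos_le_one _)).trans hs1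
  · rw [← mul_sub, abs_mul, shift]
    calc |s| * |Real.cos (s * u + θ + s * v) - Real.cos (s * u + θ)| ≤ |s| * |s * v| := by
          refine mul_le_mul_of_nonneg_left ?_ (abs_nonneg s)
          simpa only [add_sub_cancel_left] using Real.abs_cos_sub_cos_le (s * u + θ + s * v) (s * u + θ)
      _ = |s| ^ 2 * |v| := by rw [abs_mul]; ring
      _ ≤ _ := by gcongr
  · rw [lin]
    refine (abs_sin_add_sub_le _ _).trans ?_
    rw [mul_pow]
    gcongr
    linarith
  · rw [lin]
    refine (abs_sin_add_sub_le_linear _ _).trans ?_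
    rw [abs_mul, mul_assoc]
    gcongr

/-- Trigonometric moments of the normalized off-diagonal form are nearly Gaussian. -/
theorem abs_prodExp_sin_offDiagForm_sub_le [Nonempty ι] (hp : ∀ a, 0 < p a) (hs : ∑ a, p a = 1)
    {c ε K : ℝ} (hc : c ^ 2 = 2 / ((Fintype.card ι : ℝ) ^ 2 * Fintype.card α))
    (hε : 0 < ε) (hK : 0 ≤ K)
    {n m b V : ℝ} (hn : n = Fintype.card ι) (hm : m = Fintype.card α)
    (hb : b = ∑ a, if (p a)⁻¹ ≤ K * m then (0 : ℝ) else 1)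
    (hV : V = ∑ a, p a * ((p a)⁻¹ - m) ^ 2) (t θ : ℝ) :
    |prodExp p (fun x : ι → α => Real.sin (t * (c / 2 * offDiagForm p Finset.univ x) + θ))
        - Real.sin θ * Real.exp (-t ^ 2 / 2)|
      ≤ (1 + t ^ 2) * |t| * steinError n m b V ε K := by
  have key := abs_sub_mul_exp_le_of_approx_ode (t := t) (R := (1 + t ^ 2) * steinError n m b V ε K)
    (fun s => hasDerivAt_prodExp_sin (p := p)
      (fun x : ι → α => c / 2 * offDiagForm p Finset.univ x) θ s) (fun s hst => ?_)
  · simp only [zero_mul, zero_add, prodExp_const hs] at key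
    refine key.trans_eq (by ring)
  -- Shifting the phase by π/2 turns Stein's equation for the sine into y' + s·y ≈ 0.
  · have h := abs_prodExp_stein_sin_le (ι := ι) hp hs hc hε hK hn hm hb hV s (θ + Real.pi / 2)
    simp only [← add_assoc, Real.sin_add_pi_div_two, Real.cos_add_pi_div_two, mul_neg] at h
    have e : prodExp p (fun x : ι → α =>
          -(s * Real.sin (s * (c / 2 * offDiagForm p Finset.univ x) + θ)))
        = -(s * prodExp p (fun x : ι → α =>
          Real.sin (s * (c / 2 * offDiagForm p Finset.univ x) + θ))) := by
      rw [← neg_mul, ← prodExp_const_mul]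
      simp only [neg_mul]
    rw [e, sub_neg_eq_add] at h
    have hE : 0 ≤ steinError n m b V ε K := by
      have h0 : (0 : ℝ) < 1 + s ^ 2 := by positivity
      exact nonneg_of_mul_nonneg_right ((abs_nonneg _).trans h) h0
    refine h.trans ?_
    have := sq_le_sq.2 hst
    gcongr

end Trigonometric

/-! ### Pearson's statistic as a quadratic form. -/

section Pearson

variable {n m : ℕ} {p : Fin m → ℝ}

theorem kernelSum_univ_eq (b : Fin m) (x : Fin n → Fin m) :
    kernelSum p Finset.univ b x
      = (∑ k : Fin n, if x k = b then (1 : ℝ) else 0) / p b - n := by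
  simp only [kernelSum, pearsonKernel, Finset.sum_sub_distrib, Finset.sum_div]
  congr 1
  · refine Finset.sum_congr rfl fun k _ => ?_
    by_cases h : x k = b
    · simp [h]
    · simp [h, Ne.symm h]
  · simp

theorem pearsonChiSq_eq_kernelForm (hn : 1 ≤ n) (hp : ∀ a, 0 < p a) (hs : ∑ a, p a = 1)
    (x : Fin n → Fin m) :
    pearsonChiSq p (fun k (x : Fin n → Fin m) => x k) x = kernelForm p Finset.univ x / n := by
  have hn0 : (n : ℝ) ≠ 0 := by positivity
  rw [← sum_mul_kernelSum_sq hp hs, pearsonChiSq, Finset.mul_sum, Finset.sum_div]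
  refine Finset.sum_congr rfl fun b _ => ?_
  rw [kernelSum_univ_eq, empFreq]
  have := (hp b).ne'
  field_simp

/-- The standardized Pearson statistic splits into off-diagonal part and remainder. -/
theorem standardized_pearsonChiSq_eq (hn : 1 ≤ n) (hp : ∀ a, 0 < p a) (hs : ∑ a, p a = 1)
    (x : Fin n → Fin m) :
    (pearsonChiSq p (fun k (x : Fin n → Fin m) => x k) x - m) / √(2 * (m : ℝ))
      = 2 / (n * √(2 * (m : ℝ))) / 2 * offDiagForm p Finset.univ x
        + (diagForm p Finset.univ x - n) / (n * √(2 * (m : ℝ))) := by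
  have hn0 : (n : ℝ) ≠ 0 := by positivity
  have hm := one_le_card_of_sum_eq_one hs
  rw [Fintype.card_fin] at hm
  have hr : √(2 * (m : ℝ)) ≠ 0 := by positivity
  rw [pearsonChiSq_eq_kernelForm hn hp hs, kernelForm_eq, Finset.card_univ, Fintype.card_fin,
    Fintype.card_fin]
  field_simp
  ring

/-- From |Y| ≤ ε + Y²/ε and the variance of the diagonal part; the extra 1/m comes from the
deterministic shift −n. -/
theorem prodExp_abs_remainder_le (hn : 1 ≤ n) (hp : ∀ a, 0 < p a) (hs : ∑ a, p a = 1) {ε V : ℝ}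
    (hε : 0 < ε) (hV : V = ∑ a, p a * ((p a)⁻¹ - m) ^ 2) :
    prodExp p (fun x : Fin n → Fin m =>
        |(diagForm p Finset.univ x - n) / (n * √(2 * (m : ℝ)))|)
      ≤ ε + ((m * n : ℝ)⁻¹ * V + (m : ℝ)⁻¹) / ε := by
  have hn0 : (0 : ℝ) < n := by positivity
  have hm := one_le_card_of_sum_eq_one hs
  rw [Fintype.card_fin] at hm
  have hm0 : (0 : ℝ) < m := by linarith
  have hG := prodExp_diagForm_sq hp hs (Finset.univ : Finset (Fin n))
  rw [Finset.card_univ, Fintype.card_fin, Fintype.card_fin, ← hV] at hG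
  refine (prodExp_mono (fun a => (hp a).le) (G := fun x : Fin n → Fin m =>
    ε + 1 / (ε * (n ^ 2 * m)) * (diagForm p Finset.univ x ^ 2 + (n : ℝ) ^ 2)) fun x => ?_).trans_eq ?_
  · have hY : ∀ Y : ℝ, |Y| ≤ ε + Y ^ 2 / ε := by
      intro Y
      rw [← sq_abs Y, ← sub_nonneg]
      have : ε + |Y| ^ 2 / ε - |Y| = ((ε - |Y|) ^ 2 + ε * |Y|) / ε := by
        field_simp
        ring
      rw [this]
      positivity
    refine (hY _).trans ?_
    rw [div_pow, mul_pow, Real.sq_sqrt (by positivity)]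
    have : (diagForm p Finset.univ x - n) ^ 2 ≤ 2 * (diagForm p Finset.univ x ^ 2 + (n : ℝ) ^ 2) := by
      nlinarith [sq_nonneg (diagForm p Finset.univ x + n)]
    calc ε + (diagForm p Finset.univ x - n) ^ 2 / (n ^ 2 * (2 * m)) / ε
        ≤ ε + 2 * (diagForm p Finset.univ x ^ 2 + (n : ℝ) ^ 2) / (n ^ 2 * (2 * m)) / ε := by gcongr
      _ = _ := by field_simp
  · rw [prodExp_add, prodExp_const hs, prodExp_const_mul, prodExp_add, prodExp_const hs, hG]
    field_simp

theorem abs_prodExp_sin_pearson_sub_le (hn : 1 ≤ n) (hp : ∀ a, 0 < p a) (hs : ∑ a, p a = 1)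
    {ε K b V : ℝ} (hε : 0 < ε) (hK : 0 ≤ K)
    (hb : b = ∑ a, if (p a)⁻¹ ≤ K * m then (0 : ℝ) else 1)
    (hV : V = ∑ a, p a * ((p a)⁻¹ - m) ^ 2) (t θ : ℝ) :
    |prodExp p (fun x : Fin n → Fin m => Real.sin (t * ((pearsonChiSq p
          (fun k (x : Fin n → Fin m) => x k) x - m) / √(2 * (m : ℝ))) + θ))
        - Real.sin θ * Real.exp (-t ^ 2 / 2)|
      ≤ (1 + t ^ 2) * |t| * steinError n m b V ε K
        + |t| * (ε + ((m * n : ℝ)⁻¹ * V + (m : ℝ)⁻¹) / ε) := by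
  have hn0 : (0 : ℝ) < n := by positivity
  have hm := one_le_card_of_sum_eq_one hs
  rw [Fintype.card_fin] at hm
  have hm0 : (0 : ℝ) < m := by linarith
  have : Nonempty (Fin n) := ⟨⟨0, hn⟩⟩
  set c : ℝ := 2 / (n * √(2 * (m : ℝ))) with hcdef
  have hc : c ^ 2 = 2 / ((Fintype.card (Fin n) : ℝ) ^ 2 * Fintype.card (Fin m)) := by
    rw [hcdef, div_pow, mul_pow, Real.sq_sqrt (by positivity), Fintype.card_fin, Fintype.card_fin]
    field_simp
  have main := abs_prodExp_sin_offDiagForm_sub_le (ι := Fin n) hp hs hc hε hK (n := n) (m := m)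
    (by rw [Fintype.card_fin]) (by rw [Fintype.card_fin]) hb hV t θ
  have rem : |prodExp p (fun x : Fin n → Fin m => Real.sin (t * ((pearsonChiSq p
          (fun k (x : Fin n → Fin m) => x k) x - m) / √(2 * (m : ℝ))) + θ))
        - prodExp p (fun x : Fin n → Fin m =>
          Real.sin (t * (c / 2 * offDiagForm p Finset.univ x) + θ))|
      ≤ |t| * (ε + ((m * n : ℝ)⁻¹ * V + (m : ℝ)⁻¹) / ε) := by
    rw [← prodExp_sub]
    refine (prodExp_abs_le (fun a => (hp a).le) _).trans ?_
    refine (prodExp_mono (fun a => (hp a).le) (G := fun x : Fin n → Fin m =>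
      |t| * |(diagForm p Finset.univ x - n) / (n * √(2 * (m : ℝ)))|) fun x => ?_).trans ?_
    · rw [standardized_pearsonChiSq_eq hn hp hs, ← hcdef]
      refine (Real.abs_sin_sub_sin_le _ _).trans_eq ?_
      rw [← abs_mul]
      congr 1
      ring
    · rw [prodExp_const_mul]
      gcongr
      exact prodExp_abs_remainder_le hn hp hs hε hV
  rw [abs_le] at main rem ⊢
  constructor <;> linarith [main.1, main.2, rem.1, rem.2]

end Pearson

/-! ### Passage to the limit. -/

section Limits

/-- Classes of very small probability are rare under a moment bound. -/
theorem exists_rareClasses_le {m : ℕ → ℕ} {p : ∀ n, Fin (m n) → ℝ} (hp : ∀ n, 1 ≤ n → ∀ i, 0 < p n i)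
    (hs : ∀ n, 1 ≤ n → ∑ i, p n i = 1) {δ C : ℝ} (hδ : 0 < δ)
    (hC : ∀ n, 1 ≤ n → (m n : ℝ) ^ (-(1 + δ)) * ∑ i, p n i * p n i ^ (-(1 + δ)) ≤ C)
    {η : ℝ} (hη : 0 < η) :
    ∃ K : ℝ, 0 < K ∧ ∀ n, 1 ≤ n →
      (∑ a, if (p n a)⁻¹ ≤ K * m n then (0 : ℝ) else 1) / m n ≤ η := by
  have hlim : Tendsto (fun K : ℝ => K ^ (-δ) * C) atTop (𝓝 (0 * C)) :=
    (tendsto_rpow_neg_atTop hδ).mul_const C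
  rw [zero_mul] at hlim
  obtain ⟨K, hK, hK0⟩ := ((hlim.eventually_le_const hη).and (eventually_gt_atTop 0)).exists
  refine ⟨K, hK0, fun n hn => le_trans ?_ hK⟩
  have hm := one_le_card_of_sum_eq_one (hs n hn)
  rw [Fintype.card_fin] at hm
  have hm0 : (0 : ℝ) < m n := by linarith
  -- Markov's inequality for uniform counting of classes: the indicator of 1/p > Km is at most
  -- (1/(pKm))^δ.
  have hterm : ∀ a, (if (p n a)⁻¹ ≤ K * m n then (0 : ℝ) else 1)
      ≤ K ^ (-δ) * (m n : ℝ) ^ (-δ) * (p n a * p n a ^ (-(1 + δ))) := by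
    intro a
    have hpa := hp n hn a
    have e : K ^ (-δ) * (m n : ℝ) ^ (-δ) * (p n a * p n a ^ (-(1 + δ)))
        = ((p n a)⁻¹ / (K * m n)) ^ δ := by
      rw [Real.div_rpow (by positivity) (by positivity), Real.mul_rpow hK0.le hm0.le,
        Real.inv_rpow hpa.le, Real.rpow_neg hK0.le, Real.rpow_neg hm0.le, Real.rpow_neg hpa.le,
        Real.rpow_add hpa, Real.rpow_one]
      field_simp
    rw [e]
    split_ifs with h
    · positivity
    · refine Real.one_le_rpow ?_ hδ.le
      rw [one_le_div (by positivity)]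
      exact (not_le.1 h).le
  calc (∑ a, if (p n a)⁻¹ ≤ K * m n then (0 : ℝ) else 1) / m n
      ≤ (∑ a, K ^ (-δ) * (m n : ℝ) ^ (-δ) * (p n a * p n a ^ (-(1 + δ)))) / m n := by
        gcongr with a
        exact hterm a
    _ = K ^ (-δ) * ((m n : ℝ) ^ (-(1 + δ)) * ∑ i, p n i * p n i ^ (-(1 + δ))) := by
        rw [← Finset.mul_sum, neg_add, Real.rpow_add hm0, Real.rpow_neg_one]
        field_simp
    _ ≤ K ^ (-δ) * C := by
        gcongr
        exact hC n hn

theorem exists_steinError_le {m V : ℕ → ℝ} {b : ℕ → ℝ → ℝ} (hm0 : ∀ n, 1 ≤ n → 0 < m n)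
    (hm : Tendsto m atTop atTop) (hV : Tendsto (fun n : ℕ => (m n * n)⁻¹ * V n) atTop (𝓝 0))
    (hratio : Tendsto (fun n : ℕ => (n : ℝ) / √(m n)) atTop atTop)
    (hb : ∀ η : ℝ, 0 < η → ∃ K : ℝ, 0 < K ∧ ∀ n, 1 ≤ n → b n K / m n ≤ η) {η : ℝ} (hη : 0 < η) :
    ∃ ε K : ℝ, 0 < ε ∧ 0 < K ∧ ∀ᶠ n : ℕ in atTop, steinError n (m n) (b n K) (V n) ε K ≤ η
      ∧ ε + ((m n * n)⁻¹ * V n + (m n)⁻¹) / ε ≤ η := by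
  -- K is fixed first, uniformly in n, then ε = η/12, then n is taken large: 2·η/8 + 3·η/12 + η/4 ≤
  -- η.
  obtain ⟨K, hK, hbK⟩ := hb (η / 8) (by positivity)
  have h1 : Tendsto (fun n : ℕ => (n : ℝ)⁻¹) atTop (𝓝 0) :=
    tendsto_inv_atTop_zero.comp tendsto_natCast_atTop_atTop
  have h2 : Tendsto (fun n => (m n)⁻¹) atTop (𝓝 0) := tendsto_inv_atTop_zero.comp hm
  -- This is m/n² = (n/√m)⁻², the term governed by the growth condition on n.
  have h3 : Tendsto (fun n : ℕ => m n * (n : ℝ)⁻¹ ^ 2) atTop (𝓝 0) := by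
    have := (tendsto_inv_atTop_zero.comp hratio).pow 2
    rw [zero_pow two_ne_zero] at this
    refine this.congr' ?_
    filter_upwards [eventually_ge_atTop 1] with n hn
    simp only [Function.comp_apply]
    rw [inv_div, div_pow, Real.sq_sqrt (hm0 n hn).le]
    ring
  have hA : Tendsto (fun n : ℕ => 2 * K ^ 2 * (m n * (n : ℝ)⁻¹ ^ 2) + 6 * K * (n : ℝ)⁻¹
      + 12 * ((n : ℝ)⁻¹ * (m n)⁻¹) + 6 * (((m n * n)⁻¹ * V n) * ((n : ℝ)⁻¹ * (m n)⁻¹))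
      + 6 * (n : ℝ)⁻¹ + 3 * (2 * (m n)⁻¹ + ((m n * n)⁻¹ * V n) * (m n)⁻¹
        + ((n : ℝ)⁻¹ + (m n)⁻¹) ^ 2)) atTop (𝓝 0) := by
    have := (((((h3.const_mul (2 * K ^ 2)).add (h1.const_mul (6 * K))).add
      ((h1.mul h2).const_mul 12)).add ((hV.mul (h1.mul h2)).const_mul 6)).add
      (h1.const_mul 6)).add
      ((((h2.const_mul 2).add (hV.mul h2)).add ((h1.add h2).pow 2)).const_mul 3)
    simpa using this
  have hB : Tendsto (fun n : ℕ => (m n * n)⁻¹ * V n + (m n)⁻¹) atTop (𝓝 0) := by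
    simpa using hV.add h2
  refine ⟨η / 12, K, by positivity, hK, ?_⟩
  have hpos : (0 : ℝ) < η / 4 * (η / 12) := by positivity
  filter_upwards [hA.eventually_le_const hpos, hB.eventually_le_const hpos, eventually_ge_atTop 1]
    with n hn1 hn2 hn
  constructor
  · have hbn := hbK n hn
    have : steinError n (m n) (b n K) (V n) (η / 12) K = 2 * (b n K / m n) + 3 * (η / 12)
        + (2 * K ^ 2 * (m n * (n : ℝ)⁻¹ ^ 2) + 6 * K * (n : ℝ)⁻¹
      + 12 * ((n : ℝ)⁻¹ * (m n)⁻¹) + 6 * (((m n * n)⁻¹ * V n) * ((n : ℝ)⁻¹ * (m n)⁻¹))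
      + 6 * (n : ℝ)⁻¹ + 3 * (2 * (m n)⁻¹ + ((m n * n)⁻¹ * V n) * (m n)⁻¹
        + ((n : ℝ)⁻¹ + (m n)⁻¹) ^ 2)) / (η / 12) := by
      rw [steinError]
      congr 2
      ring
    rw [this]
    have h := (div_le_iff₀ (by positivity : (0 : ℝ) < η / 12)).2 hn1
    linarith
  · have h := (div_le_iff₀ (by positivity : (0 : ℝ) < η / 12)).2 hn2
    linarith

/-- Convergence of the trigonometric moments of the standardized Pearson statistic. -/
theorem tendsto_prodExp_sin_pearson {m : ℕ → ℕ} {p : ∀ n, Fin (m n) → ℝ} {V : ℕ → ℝ}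
    (hp : ∀ n, 1 ≤ n → ∀ i, 0 < p n i) (hs : ∀ n, 1 ≤ n → ∑ i, p n i = 1)
    (hm : Tendsto m atTop atTop)
    (hVeq : ∀ n, 1 ≤ n → V n = ∑ i, p n i * ((p n i)⁻¹ - m n) ^ 2)
    (hV : Tendsto (fun n : ℕ => ((m n : ℝ) * n)⁻¹ * V n) atTop (𝓝 0))
    (hratio : Tendsto (fun n : ℕ => (n : ℝ) / √(m n : ℝ)) atTop atTop) {δ C : ℝ} (hδ : 0 < δ)
    (hC : ∀ n, 1 ≤ n → (m n : ℝ) ^ (-(1 + δ)) * ∑ i, p n i * p n i ^ (-(1 + δ)) ≤ C) (t θ : ℝ) :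
    Tendsto (fun n => prodExp (p n) (fun x : Fin n → Fin (m n) =>
        Real.sin (t * ((pearsonChiSq (p n) (fun k (x : Fin n → Fin (m n)) => x k) x - m n)
          / √(2 * (m n : ℝ))) + θ))) atTop (𝓝 (Real.sin θ * Real.exp (-t ^ 2 / 2))) := by
  rw [Metric.tendsto_atTop']
  intro r hr
  -- The added 1 keeps A positive at t = 0.
  set A := (1 + t ^ 2) * |t| + |t| + 1 with hA
  have hA0 : 0 < A := by positivity
  obtain ⟨ε, K, hε, hK, hev⟩ := exists_steinError_le (m := fun n => (m n : ℝ)) (V := V)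
    (b := fun n K => ∑ a, if (p n a)⁻¹ ≤ K * m n then (0 : ℝ) else 1)
    (fun n hn => by
      have := one_le_card_of_sum_eq_one (hs n hn)
      rw [Fintype.card_fin] at this
      linarith)
    (tendsto_natCast_atTop_atTop.comp hm) hV hratio
    (fun η hη => exists_rareClasses_le hp hs hδ hC hη) (η := r / (2 * A)) (by positivity)
  obtain ⟨n₀, hn₀⟩ := (hev.and (eventually_ge_atTop 1)).exists_forall_of_atTop
  refine ⟨n₀, fun n hn => ?_⟩
  obtain ⟨⟨h1, h2⟩, hn1⟩ := hn₀ n hn.le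
  rw [Real.dist_eq]
  refine (abs_prodExp_sin_pearson_sub_le hn1 (hp n hn1) (hs n hn1) hε hK.le rfl (hVeq n hn1)
    t θ).trans_lt ?_
  calc _ ≤ (1 + t ^ 2) * |t| * (r / (2 * A)) + |t| * (r / (2 * A)) := by gcongr
    _ ≤ A * (r / (2 * A)) := by
      rw [← add_mul]
      gcongr
      linarith
    _ = r / 2 := by field_simp
    _ < r := by linarith

end Limits

/-! ### From random variables to finite sums, and the conclusion. -/

section Transfer

theorem integral_comp_eq_sum {Ω β E : Type*} [MeasurableSpace Ω] {P : Measure Ω}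
    [IsProbabilityMeasure P] [Fintype β] [MeasurableSpace β] [MeasurableSingletonClass β]
    [NormedAddCommGroup E] [NormedSpace ℝ E] [CompleteSpace E]
    {X : Ω → β} (hX : AEMeasurable X P) (f : β → E) :
    ∫ ω, f (X ω) ∂P = ∑ a, P.real {ω | X ω = a} • f a := by
  have := Measure.isProbabilityMeasure_map hX
  rw [← integral_map hX (f := f) StronglyMeasurable.of_discrete.aestronglyMeasurable,
    integral_fintype .of_finite]
  refine Finset.sum_congr rfl fun a _ => ?_
  rw [Measure.real, Measure.map_apply_of_aemeasurable hX (measurableSet_singleton a)]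
  rfl

theorem measureReal_pi_eq_prod_of_iIndepFun {Ω ι α : Type*} [MeasurableSpace Ω] {P : Measure Ω}
    [Fintype ι] [MeasurableSpace α] [MeasurableSingletonClass α] {X : ι → Ω → α}
    (h : iIndepFun X P) (x : ι → α) :
    P.real {ω | (fun k => X k ω) = x} = ∏ k, P.real {ω | X k ω = x k} := by
  have := h.measure_inter_preimage_eq_mul Finset.univ (sets := fun k => {x k})
    (fun k _ => measurableSet_singleton _)
  have e : {ω | (fun k => X k ω) = x} = ⋂ k ∈ Finset.univ, X k ⁻¹' {x k} := by
    ext ω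
    simp [funext_iff]
  rw [e, Measure.real, this, ENNReal.toReal_prod]
  rfl

end Transfer

/-- The characteristic function of a real function of i.i.d. finitely valued variables. -/
theorem charFun_map_iid_eq {Ω ι α : Type*} [MeasurableSpace Ω] {P : Measure Ω}
    [IsProbabilityMeasure P] [Fintype ι] [DecidableEq ι] [Fintype α] [MeasurableSpace α]
    [MeasurableSingletonClass α] {X : ι → Ω → α} {p : α → ℝ}
    (hX : ∀ k, AEMeasurable (X k) P) (hindep : iIndepFun X P)
    (hlaw : ∀ k a, P.real {ω | X k ω = a} = p a) (f : (ι → α) → ℝ) (t : ℝ) :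
    charFun (P.map (fun ω => f (fun k => X k ω))) t
      = (prodExp p (fun x => Real.sin (t * f x + Real.pi / 2)) : ℂ)
        + (prodExp p (fun x => Real.sin (t * f x + 0)) : ℂ) * Complex.I := by
  have hXv : AEMeasurable (fun ω k => X k ω) P := aemeasurable_pi_lambda _ hX
  have hY : AEMeasurable (fun ω => f (fun k => X k ω)) P :=
    (measurable_of_finite f).comp_aemeasurable hXv
  rw [charFun_apply_real, integral_map hY (by fun_prop),
    integral_comp_eq_sum hXv (fun x => Complex.exp (t * f x * Complex.I))]
  simp only [measureReal_pi_eq_prod_of_iIndepFun hindep, hlaw, prodExp]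
  push_cast
  rw [Finset.sum_mul, ← Finset.sum_add_distrib]
  refine Finset.sum_congr rfl fun x _ => ?_
  rw [add_zero, Complex.sin_add_pi_div_two, Complex.exp_mul_I, Complex.real_smul]
  push_cast
  ring

theorem theorem2
    (m : ℕ → ℕ) (hm : Tendsto m atTop atTop)
    (p : ∀ n : ℕ, Fin (m n) → ℝ) (hp : ∀ n, 1 ≤ n → ∀ i, 0 < p n i)
    -- the generic variables `X_n`, with `P(X_n = i) = p_n(i)`
    {Ω₀ : ℕ → Type*} [∀ n, MeasurableSpace (Ω₀ n)]
    (P₀ : ∀ n, Measure (Ω₀ n)) [∀ n, IsProbabilityMeasure (P₀ n)]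
    (X₀ : ∀ n, Ω₀ n → Fin (m n))
    (hX₀ : ∀ n, 1 ≤ n → ∀ i, (P₀ n).real {ω | X₀ n ω = i} = p n i)
    -- the rows of the array: `n` independent copies of `X_n`
    {Ω : ℕ → Type*} [∀ n, MeasurableSpace (Ω n)]
    (P : ∀ n, Measure (Ω n)) [∀ n, IsProbabilityMeasure (P n)]
    (X : ∀ n, Fin n → Ω n → Fin (m n))
    (hident : ∀ n k, IdentDistrib (X n k) (X₀ n) (P n) (P₀ n))
    (hindep : ∀ n, 1 ≤ n → iIndepFun (X n) (P n))
    (hC : Tendsto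
      (fun n : ℕ => ((m n : ℝ) * n)⁻¹ * Var[fun ω => (p n (X₀ n ω))⁻¹; P₀ n]) atTop (𝓝 0))
    (δ : ℝ) (hδ : 0 < δ)
    (hmom : BddAbove ((fun n : ℕ => (m n : ℝ) ^ (-(1 + δ)) *
      ∫ ω, (p n (X₀ n ω)) ^ (-(1 + δ)) ∂(P₀ n)) '' {n | 1 ≤ n}))
    (hratio : Tendsto (fun n : ℕ => (n : ℝ) / √(m n : ℝ)) atTop atTop)
    {Ω' : Type*} [MeasurableSpace Ω'] (P' : Measure Ω') [IsProbabilityMeasure P']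
    (N : Ω' → ℝ) (hN : HasLaw N (gaussianReal 0 1) P') :
    TendstoInDistribution
      (fun (n : ℕ) ω => (pearsonChiSq (p n) (X n) ω - m n) / √(2 * (m n : ℝ)))
      atTop N P P' := by
  have hmeas₀ : ∀ n, 1 ≤ n → AEMeasurable (X₀ n) (P₀ n) :=
    fun n hn => (hident n ⟨0, hn⟩).aemeasurable_snd
  have hmeas : ∀ n k, AEMeasurable (X n k) (P n) := fun n k => (hident n k).aemeasurable_fst
  have hexp : ∀ n, 1 ≤ n → ∀ f : Fin (m n) → ℝ,
      ∫ ω, f (X₀ n ω) ∂(P₀ n) = ∑ i, p n i * f i := by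
    intro n hn f
    rw [integral_comp_eq_sum (hmeas₀ n hn)]
    simp only [hX₀ n hn, smul_eq_mul]
  have hs : ∀ n, 1 ≤ n → ∑ i, p n i = 1 := by
    intro n hn
    simpa using (hexp n hn (fun _ => 1)).symm
  -- As 1/p(X) has mean m, the variance in (C) is the second moment of the centred diagonal terms.
  have hVeq : ∀ n, 1 ≤ n → Var[fun ω => (p n (X₀ n ω))⁻¹; P₀ n]
      = ∑ i, p n i * ((p n i)⁻¹ - m n) ^ 2 := by
    intro n hn
    have hmean : ∫ ω, (p n (X₀ n ω))⁻¹ ∂(P₀ n) = m n := by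
      rw [hexp n hn (fun i => (p n i)⁻¹)]
      simp [mul_inv_cancel₀ (hp n hn _).ne']
    have hinv : AEMeasurable (fun ω => (p n (X₀ n ω))⁻¹) (P₀ n) :=
      (measurable_of_finite fun i => (p n i)⁻¹).comp_aemeasurable (hmeas₀ n hn)
    rw [variance_eq_integral hinv, hmean]
    exact hexp n hn (fun i => ((p n i)⁻¹ - m n) ^ 2)
  obtain ⟨C, hCb⟩ := hmom
  have hbound : ∀ n, 1 ≤ n →
      (m n : ℝ) ^ (-(1 + δ)) * ∑ i, p n i * p n i ^ (-(1 + δ)) ≤ C := by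
    intro n hn
    rw [← hexp n hn (fun i => p n i ^ (-(1 + δ)))]
    exact hCb ⟨n, hn, rfl⟩
  have hlaw : ∀ n, 1 ≤ n → ∀ k i, (P n).real {ω | X n k ω = i} = p n i := by
    intro n hn k i
    rw [← hX₀ n hn i]
    exact congrArg ENNReal.toReal ((hident n k).measure_mem_eq (measurableSet_singleton i))
  let Y : ∀ n, (Fin n → Fin (m n)) → ℝ := fun n x =>
    (pearsonChiSq (p n) (fun k (x : Fin n → Fin (m n)) => x k) x - m n) / √(2 * (m n : ℝ))
  refine ⟨fun n => ?_, hN.aemeasurable, ?_⟩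
  · exact (measurable_of_finite (Y n)).comp_aemeasurable (aemeasurable_pi_lambda _ (hmeas n))
  · refine ProbabilityMeasure.tendsto_iff_tendsto_charFun.2 fun t => ?_
    simp only [ProbabilityMeasure.coe_mk, hN.map_eq, charFun_gaussianReal]
    -- The phases π/2 and 0 give the real and imaginary parts of the characteristic function.
    have lim := fun θ => tendsto_prodExp_sin_pearson hp hs hm hVeq hC hratio hδ hbound t θ
    have l1 := (Complex.continuous_ofReal.tendsto _).comp (lim (Real.pi / 2))
    have l2 := ((Complex.continuous_ofReal.tendsto _).comp (lim 0)).mul_const Complex.I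
    have l := l1.add l2
    have e : ((Real.sin (Real.pi / 2) * Real.exp (-t ^ 2 / 2) : ℝ) : ℂ)
        + ((Real.sin 0 * Real.exp (-t ^ 2 / 2) : ℝ) : ℂ) * Complex.I
        = Complex.exp (t * (0 : ℝ) * Complex.I - ((1 : NNReal) : ℝ) * t ^ 2 / 2) := by
      rw [Real.sin_pi_div_two, Real.sin_zero]
      push_cast
      simp only [one_mul, zero_mul, add_zero, mul_zero, zero_sub]
      congr 1
      ring
    rw [e] at l
    refine l.congr' ?_
    filter_upwards [eventually_ge_atTop 1] with n hn
    exact (charFun_map_iid_eq (hmeas n) (hindep n hn) (hlaw n hn) (Y n) t).symm
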